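/- **Setting.** Let $\mathcal C\subset\mathbb R^2=\mathbb C$ be the unit circle with geodesic distance $d$, let $\mathcal O$ be the orthogonal group of $\mathbb R^2$, and for tuples $x,y$ of points of $\mathcal C$ put $d_\infty(x,y)=\max_i d(x_i,y_i)$ and $Qx=(Qx_i)_i$. Let $n\ge 1$ be a multiple of $4$ and $n_0=n/4$. For $c_e\ge 0$ and $0<c_l\le c_L$, let $\mathcal{BL}[c_l,c_L,c_e]$ be the set of symmetric functions $f:\mathcal C^2\to[0,1]$ such that, with $\varepsilon_n=c_e\sqrt{\log(n)/n}$, for all $x,y,y'\in\mathcal C$, $$|f(x,y)-f(x,y')|\le c_L\,d(y,y')+\varepsilon_n,\qquad f(x,y')-f(x,y)\ge c_l\,(d(x,y)-d(x,y'))-\varepsilon_n\ \text{ if } d(x,y)\ge d(x,y').$$ Let $x^*_1,\dots,x^*_n$ be i.i.d. uniform on $\mathcal C$ and $f\in\mathcal{BL}[c_l,c_L,c_e]$. We observe a random symmetric matrix $A\in\mathbb R^{n\times n}$ with zero diagonal such that, conditionally on $x^*=(x_1^*,\dots,x_n^*)$: $\mathbb E[A_{ij}]=f(x^*_i,x^*_j)$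 for $i<j$, and the fluctuations $E_{ij}=A_{ij}-f(x^*_i,x^*_j)$, $i<j$, are independent and subGaussian(1), that is, for all $B\in\mathbb R^{n\times n}$ and $t\ge 0$, $\mathbb P\big[\sum_{i<j}B_{ij}E_{ij}>t\,(\sum_{i<j}B_{ij}^2)^{1/2}\big]\le e^{-t^2/2}$. **Estimator (Localize-and-Refine).** Let $\mathcal C_k=\{e^{2\pi \iota j/k}:0\le j<k\}$; for a finite set $T$ of size $k$, let $\Pi_T$ be the set of tuples $(y_i)_{i\in T}$ that enumerate $\mathcal C_k$ bijectively. 1. Independently of $(x^*,A)$, draw $S\subset[n]$ uniformly among the subsets of size $n_0$, then $S'\subset\overline S=[n]\setminus S$ uniformly among the subsets of $\overline S$ of size $n_0$. 2. Choose $\hat x^{(1)}_S\in\arg\min_{y\in\Pi_S}\sum_{i,j\in S}A_{ij}\,d(y_i,y_j)$, where ties are broken by an arbitrary measurable rule that depends only on $S$ and $A_{SS}=[A_{ij}]_{i,j\in S}$; then, for each $i\in\overline S$, choose $\hat x^{(2)}_i\in\arg\min_{z\in\mathcal C_{n_0}}\sum_{j\in S}A_{ij}\,d(z,\hat x^{(1)}_j)$.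 3. Do the same with $S'$ in place of $S$, which gives $\hat x^{(1')}_{S'}$ and $\hat x^{(2')}_i$ for $i\in\overline{S'}$. 4. Choose $\hat Q\in\arg\min_{Q\in\mathcal O}\max_{i\in\overline S\cap\overline{S'}}d(\hat x^{(2)}_i,Q\hat x^{(2')}_i)$, and set $\hat x_j=\hat x^{(2)}_j$ for $j\in\overline S$ and $\hat x_j=\hat Q\hat x^{(2')}_j$ for $j\in S$. **Corollary 3.3.** For all $c_e\ge 0$ and $0<c_l\le c_L$ there is a constant $C>0$, depending only on $c_e,c_l,c_L$, such that in the setting above, for every $n\ge1$ divisible by $4$, every $f\in\mathcal{BL}[c_l,c_L,c_e]$, every conditional law of $A$ as above and all choices of minimizers as above (with $\hat x$ measurable), with probability at least $1-7/n^2$, $$\min_{Q\in\mathcal O}d_\infty(\hat x,Qx^*)\le C\sqrt{\frac{\log n}{n}}.$$ -/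

import Mathlib

open MeasureTheory ProbabilityTheory Set

namespace CircleLocalization

noncomputable section

/-! ## The circle -/

instance circleMeasurableSpace : MeasurableSpace Circle := borel Circle

instance circleBorelSpace : BorelSpace Circle := ⟨rfl⟩

/-- The uniform probability measure on the circle: the law of `exp (i θ)` where `θ` is
uniform on `[0, 2π)`. -/
def uniformCircle : Measure Circle :=
  (volume[|Ico (0 : ℝ) (2 * Real.pi)]).map Circle.exp

/-- The geodesic distance on the circle, i.e. the angle in `[0, π]` between two unit vectors.
Its expression through arguments in `[0, 2π)` is `geoDist_exp` below. -/
def geoDist (x y : Circle) : ℝ := InnerProductGeometry.angle (x : ℂ) (y : ℂ)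

/-- In terms of the arguments `s, t ∈ [0, 2π)`, the geodesic distance is
`min |s - t| (2π - |s - t|)`. -/
theorem geoDist_exp {s t : ℝ} (hs : s ∈ Ico 0 (2 * Real.pi)) (ht : t ∈ Ico 0 (2 * Real.pi)) :
    geoDist (Circle.exp s) (Circle.exp t) = min |s - t| (2 * Real.pi - |s - t|) := by
  have hpi := Real.pi_pos
  obtain ⟨hs0, hs1⟩ := hs
  obtain ⟨ht0, ht1⟩ := ht
  have h : geoDist (Circle.exp s) (Circle.exp t)
      = |toIocMod Real.two_pi_pos (-Real.pi) (s - t)| := by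
    rw [geoDist, Circle.coe_exp, Circle.coe_exp, Complex.angle_exp_exp]
  rw [h]
  rcases le_total t s with hst | hst
  · rw [abs_of_nonneg (sub_nonneg.2 hst)]
    rcases le_or_gt (s - t) Real.pi with h1 | h1
    · rw [(toIocMod_eq_self Real.two_pi_pos).2 ⟨by linarith, by linarith⟩,
        abs_of_nonneg (sub_nonneg.2 hst), min_eq_left (by linarith)]
    · have : toIocMod Real.two_pi_pos (-Real.pi) (s - t) = s - t - 2 * Real.pi := by
        rw [← toIocMod_sub, toIocMod_eq_self]
        exact ⟨by linarith, by linarith⟩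
      rw [this, abs_of_nonpos (by linarith), min_eq_right (by linarith)]
      ring
  · rw [abs_of_nonpos (sub_nonpos.2 hst)]
    rcases lt_or_ge (t - s) Real.pi with h1 | h1
    · rw [(toIocMod_eq_self Real.two_pi_pos).2 ⟨by linarith, by linarith⟩,
        abs_of_nonpos (sub_nonpos.2 hst), min_eq_left (by linarith)]
    · have : toIocMod Real.two_pi_pos (-Real.pi) (s - t) = s - t + 2 * Real.pi := by
        rw [← toIocMod_add_right, toIocMod_eq_self]
        exact ⟨by linarith, by linarith⟩
      rw [this, abs_of_nonneg (by linarith), min_eq_right (by linarith)]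
      ring

/-- The orthogonal group of the plane `ℝ² = ℂ` (rotations and reflections). -/
abbrev Orth : Type := ℂ ≃ₗᵢ[ℝ] ℂ

/-- The action of an orthogonal transformation on a point of the circle. -/
def rot (Q : Orth) (z : Circle) : Circle :=
  ⟨Q (z : ℂ), mem_sphere_zero_iff_norm.2 (by rw [Q.norm_map]; exact z.norm_coe)⟩

/-- `d_∞(x, y) = max_i d(x_i, y_i)` for tuples indexed by a finite type. -/
def dInf {ι : Type} [Fintype ι] (x y : ι → Circle) : ℝ := ⨆ i, geoDist (x i) (y i)

/-- `min_Q d_∞(x, Q y)` over the orthogonal group. -/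
def orthDist {ι : Type} [Fintype ι] (x y : ι → Circle) : ℝ :=
  ⨅ Q : Orth, dInf x (fun i => rot Q (y i))

/-! ## The model -/

/-- The class `BL[c_l, c_L, c_e]` of symmetric functions with values in `[0, 1]` that are
bi-Lipschitz up to the slack `ε_n = c_e √(log n / n)`. -/
structure IsBiLipschitz (n : ℕ) (cl cL ce : ℝ) (f : Circle → Circle → ℝ) : Prop where
  mem_unit : ∀ x y, f x y ∈ Icc (0 : ℝ) 1
  symm : ∀ x y, f x y = f y x
  upper : ∀ x y y',
    |f x y - f x y'| ≤ cL * geoDist y y' + ce * Real.sqrt (Real.log n / n)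
  lower : ∀ x y y', geoDist x y' ≤ geoDist x y →
    cl * (geoDist x y - geoDist x y') - ce * Real.sqrt (Real.log n / n) ≤ f x y' - f x y

/-- `P` is a possible law of the observation matrix `A` in the latent space model with fixed
latent positions `x` and affinity function `f`: `A` is symmetric with zero diagonal,
`E[A_ij] = f(x_i, x_j)` for `i < j`, and the fluctuations `A_ij - f(x_i, x_j)`, `i < j`, are
independent and subGaussian(1). -/
structure IsModelLaw {n : ℕ} (f : Circle → Circle → ℝ) (x : Fin n → Circle)
    (P : Measure (Fin n → Fin n → ℝ)) : Prop where
  symm : ∀ᵐ A ∂P, ∀ i j, A i j = A j i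
  diag : ∀ᵐ A ∂P, ∀ i, A i i = 0
  integrable : ∀ i j, i < j → Integrable (fun A => A i j) P
  mean : ∀ i j, i < j → ∫ A, A i j ∂P = f (x i) (x j)
  indep : iIndepFun (fun (p : {p : Fin n × Fin n // p.1 < p.2}) (A : Fin n → Fin n → ℝ) =>
    A p.1.1 p.1.2 - f (x p.1.1) (x p.1.2)) P
  subGaussian : ∀ (B : Fin n → Fin n → ℝ) (t : ℝ), 0 ≤ t →
    P.real {A | t * Real.sqrt (∑ p : {p : Fin n × Fin n // p.1 < p.2}, B p.1.1 p.1.2 ^ 2)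
        < ∑ p : {p : Fin n × Fin n // p.1 < p.2},
            B p.1.1 p.1.2 * (A p.1.1 p.1.2 - f (x p.1.1) (x p.1.2))}
      ≤ Real.exp (-t ^ 2 / 2)

/-! ## The Localize-and-Refine estimator -/

/-- The set `Π_k` of regular positions, for tuples indexed by a type with `k` elements. -/
def regularPositions (ι : Type) [Fintype ι] : Set (ι → Circle) :=
  {x | ∃ σ : ι ≃ Fin (Fintype.card ι),
    ∀ i, x i = Circle.exp (2 * Real.pi * (σ i : ℝ) / Fintype.card ι)}

/-- The regular grid `C_k` of `k` points on the circle. -/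
def grid (k : ℕ) : Set Circle :=
  {z | ∃ j : Fin k, z = Circle.exp (2 * Real.pi * (j : ℝ) / k)}

/-- The initial localization step: for every `S`, a measurable function of the submatrix
`A_SS` that selects a minimizer of `⟨A_SS, D(x_S)⟩` over the regular positions. The minimizer
is not unique; the selection rule is arbitrary, but sees `A` through `A_SS` only. -/
structure InitialEstimator (n : ℕ) where
  est : (S : Finset (Fin n)) → (↥S → ↥S → ℝ) → (↥S → Circle)
  measurable_est : ∀ S, Measurable (est S)
  mem_regular : ∀ (S : Finset (Fin n)) (M : ↥S → ↥S → ℝ), est S M ∈ regularPositions ↥S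
  isMin : ∀ (S : Finset (Fin n)) (M : ↥S → ↥S → ℝ),
    IsMinOn (fun y : ↥S → Circle => ∑ i, ∑ j, M i j * geoDist (y i) (y j))
      (regularPositions ↥S) (est S M)

/-- The refinement step: `x2` is a possible refined localization of the points indexed by the
complement of `S`, for the initial localization `x1` of the points indexed by `S`.
(The values of `x2` on `S` are irrelevant and never used.) -/
def IsRefined {n : ℕ} (A : Fin n → Fin n → ℝ) (S : Finset (Fin n)) (x1 : S → Circle)
    (x2 : Fin n → Circle) : Prop :=
  ∀ i, i ∉ S → x2 i ∈ grid (n / 4) ∧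
    IsMinOn (fun z : Circle => ∑ j : S, A i j * geoDist z (x1 j)) (grid (n / 4)) (x2 i)

/-- `xhat` is a possible output of the Localize-and-Refine procedure on the observation matrix
`A`, for the sampled subsets `S` and `S'`, when the initial localizations on `S` and `S'` are
computed with `init` and `init'`: the refined localizations are synchronized by a minimizer `Q`
of `d_∞` on the points outside `S ∪ S'`, and then merged. -/
def IsOutput {n : ℕ} (init init' : InitialEstimator n) (A : Fin n → Fin n → ℝ)
    (S S' : Finset (Fin n)) (xhat : Fin n → Circle) : Prop :=
  ∃ (x2 x2' : Fin n → Circle) (Q : Orth),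
    IsRefined A S (init.est S fun i j => A i j) x2 ∧
    IsRefined A S' (init'.est S' fun i j => A i j) x2' ∧
    IsMinOn (fun R : Orth => dInf (fun i : ↥(Sᶜ ∩ S'ᶜ) => x2 i)
      (fun i : ↥(Sᶜ ∩ S'ᶜ) => rot R (x2' i))) univ Q ∧
    ∀ j, xhat j = if j ∈ S then rot Q (x2' j) else x2 j

/-- The law of the pair `(S, S')`: `S` is uniform among the subsets of size `n / 4` and, given
`S`, the set `S'` is uniform among the subsets of size `n / 4` of the complement of `S`. As the
number of choices for `S'` does not depend on `S`, this is the uniform law on all such pairs. -/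
def splitLaw (n : ℕ) : Measure (Finset (Fin n) × Finset (Fin n)) :=
  uniformOn {p | p.1.card = n / 4 ∧ p.2 ⊆ p.1ᶜ ∧ p.2.card = n / 4}

end

end CircleLocalization

namespace CircleLocalization

noncomputable section

/-! ### Geodesic distance -/

/-! The signal part of both criteria is controlled by a rearrangement inequality with margin. All
points of a regular grid see the grid at the same multiset of distances, so for fixed `i` the row of
distances of any regular tuple is a permutation of that row for a reference regular tuple. As `f`
decreases with the distance at speed `cl` up to `ε_n`, permuting a row costs at least `cl / 2` times
the squared change of the distances, up to slack (`sum_mul_perm_sub_ge`).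

Initial step. The reference tuple is the grid matched in angular order with the latent points,
within `O(√(log n / n))` of them by concentration of the counts in arcs. There are at most `k ^
(2k)` noise directions, so the noise is `O(√(n log n))` times the distortion of the distances, and
optimality bounds this distortion by `O(√(n log n))`. Since cosine is 1-Lipschitz, the Gram matrices
are then close. For tuples with `∑ y_i² = 0`, the Gram discrepancy is `k² - |a|² - |b|²`, where `a`
and `b` are the correlations up to rotation and up to reflection. As `|a| + |b| ≤ k`, one of them is
nearly `k`, which yields an orthogonal alignment with mean error `O(√(log n / n))`
(`exists_orth_sum_geoDist_le`).

Refinement. For `i ∉ S`, row `i` of the noise on `S` is independent of the initial localization, so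
only `n k²` directions count and the noise level falls to `√(log n)`. An error `r` gains signal of
order `k r²` by isotropy of the grid, while the initial errors enter only through their sum,
multiplied by `r`. An average guarantee thus becomes a uniform one (`geoDist_refined_le`).

Synchronization. The two alignments, composed with the chosen `Q`, nearly agree on the well spread
common points, and a linear map that is small on such a set is small everywhere
(`geoDist_rot_rot_le`). Seven events can fail, each with probability at most `1 / n²`: three
spreads, two initial noises, two refinement noises. -/

theorem geoDist_comm (x y : Circle) : geoDist x y = geoDist y x :=
  InnerProductGeometry.angle_comm _ _

theorem geoDist_nonneg (x y : Circle) : 0 ≤ geoDist x y := InnerProductGeometry.angle_nonneg _ _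

theorem geoDist_le_pi (x y : Circle) : geoDist x y ≤ Real.pi := InnerProductGeometry.angle_le_pi _ _

theorem geoDist_triangle (x y z : Circle) : geoDist x z ≤ geoDist x y + geoDist y z :=
  InnerProductGeometry.angle_le_angle_add_angle _ _ _

theorem geoDist_self (x : Circle) : geoDist x x = 0 :=
  InnerProductGeometry.angle_self (Circle.coe_ne_zero x)

theorem abs_geoDist_sub_le (x y z : Circle) : |geoDist x z - geoDist y z| ≤ geoDist x y := by
  have h1 := geoDist_triangle x y z
  have h2 := geoDist_triangle y x z
  rw [geoDist_comm y x] at h2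
  rw [abs_le]
  constructor <;> linarith

theorem geoDist_rot (Q : Orth) (x y : Circle) : geoDist (rot Q x) (rot Q y) = geoDist x y :=
  Q.toLinearIsometry.angle_map _ _

theorem coe_rot (Q : Orth) (x : Circle) : ((rot Q x : Circle) : ℂ) = Q x := rfl

theorem rot_rot_symm (Q : Orth) (x : Circle) : rot Q (rot Q.symm x) = x := by
  ext; simp [coe_rot]

theorem rot_trans (Q R : Orth) (x : Circle) : rot (Q.trans R) x = rot R (rot Q x) := by
  ext; simp [coe_rot]

theorem geoDist_rot_left (Q : Orth) (x y : Circle) :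
    geoDist (rot Q x) y = geoDist x (rot Q.symm y) := by
  rw [← geoDist_rot Q x, rot_rot_symm]

theorem cos_geoDist (x y : Circle) : Real.cos (geoDist x y) = ((x : ℂ) * star (y : ℂ)).re := by
  rw [geoDist, InnerProductGeometry.cos_angle]
  simp [Complex.inner, mul_comm, Circle.norm_coe]

theorem norm_sub_sq_eq_cos (x y : Circle) :
    ‖(x : ℂ) - y‖ ^ 2 = 2 - 2 * Real.cos (geoDist x y) := by
  rw [geoDist, InnerProductGeometry.cos_angle, norm_sub_sq_real,
    Circle.norm_coe, Circle.norm_coe]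
  ring

theorem norm_sub_eq_sin (x y : Circle) : ‖(x : ℂ) - y‖ = 2 * Real.sin (geoDist x y / 2) := by
  have h0 := geoDist_nonneg x y
  have h1 := geoDist_le_pi x y
  have hs : 0 ≤ Real.sin (geoDist x y / 2) :=
    Real.sin_nonneg_of_nonneg_of_le_pi (by linarith) (by linarith)
  have h : ‖(x : ℂ) - y‖ ^ 2 = (2 * Real.sin (geoDist x y / 2)) ^ 2 := by
    rw [norm_sub_sq_eq_cos, mul_pow, Real.sin_sq_eq_half_sub]
    rw [mul_div_cancel₀ _ (two_ne_zero)]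
    ring
  exact (pow_left_inj₀ (norm_nonneg _) (by positivity) two_ne_zero).1 h

theorem norm_sub_le_geoDist (x y : Circle) : ‖(x : ℂ) - y‖ ≤ geoDist x y := by
  rw [norm_sub_eq_sin]
  have := Real.sin_le (x := geoDist x y / 2) (by have := geoDist_nonneg x y; linarith)
  linarith

theorem geoDist_le_norm_sub (x y : Circle) : geoDist x y ≤ Real.pi / 2 * ‖(x : ℂ) - y‖ := by
  rw [norm_sub_eq_sin]
  have h := Real.mul_le_sin (x := geoDist x y / 2) (by have := geoDist_nonneg x y; linarith)
    (by have := geoDist_le_pi x y; linarith)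
  have hp := Real.pi_pos
  calc geoDist x y = Real.pi / 2 * (2 * (2 / Real.pi * (geoDist x y / 2))) := by field_simp
    _ ≤ _ := by gcongr

theorem geoDist_mul_left (z x y : Circle) : geoDist (z * x) (z * y) = geoDist x y := by
  have := geoDist_rot (rotation z) x y
  have h : ∀ w, rot (rotation z) w = z * w := fun w => by ext; simp [coe_rot]
  rwa [h, h] at this

theorem geoDist_exp_le (s t : ℝ) : geoDist (Circle.exp s) (Circle.exp t) ≤ |s - t| := by
  rcases le_or_gt |s - t| Real.pi with h | h
  · rw [geoDist, Circle.coe_exp, Circle.coe_exp, Complex.angle_exp_exp]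
    -- The reduction takes values in `(-π, π]`, so the endpoint `-π` is not fixed by it and is
    -- treated apart.
    rcases eq_or_ne (s - t) (-Real.pi) with h' | h'
    · refine le_trans ?_ (le_of_eq (show Real.pi = |s - t| by
        rw [h', abs_neg, abs_of_pos Real.pi_pos]))
      have := toIocMod_mem_Ioc Real.two_pi_pos (-Real.pi) (s - t)
      rw [abs_le]; constructor <;> linarith [this.1, this.2]
    · rw [(toIocMod_eq_self Real.two_pi_pos).2]
      rw [abs_le] at h
      exact ⟨lt_of_le_of_ne h.1 h'.symm, by linarith [h.2]⟩
  · exact (geoDist_le_pi _ _).trans h.le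

theorem continuous_geoDist : Continuous fun p : Circle × Circle => geoDist p.1 p.2 := by
  have : (fun p : Circle × Circle => geoDist p.1 p.2)
      = fun p => Real.arccos (inner ℝ (p.1 : ℂ) (p.2 : ℂ)) := by
    funext p
    simp [geoDist, InnerProductGeometry.angle, Circle.norm_coe]
  rw [this]
  fun_prop

/-! ### Measures of discrepancy up to orthogonal transformations -/

theorem dInf_le {ι : Type} [Fintype ι] {x y : ι → Circle} {r : ℝ} (hr : 0 ≤ r)
    (h : ∀ i, geoDist (x i) (y i) ≤ r) : dInf x y ≤ r := Real.iSup_le h hr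

theorem geoDist_le_dInf {ι : Type} [Fintype ι] (x y : ι → Circle) (i : ι) :
    geoDist (x i) (y i) ≤ dInf x y :=
  le_ciSup (f := fun i => geoDist (x i) (y i)) (finite_range _).bddAbove i

theorem orthDist_le {ι : Type} [Fintype ι] {x y : ι → Circle} {r : ℝ} (hr : 0 ≤ r) (Q : Orth)
    (h : ∀ i, geoDist (x i) (rot Q (y i)) ≤ r) : orthDist x y ≤ r := by
  refine (ciInf_le ⟨0, ?_⟩ Q).trans (dInf_le hr h)
  rintro _ ⟨R, rfl⟩
  exact Real.iSup_nonneg fun i => geoDist_nonneg _ _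

theorem orthDist_le_pi {ι : Type} [Fintype ι] (x y : ι → Circle) : orthDist x y ≤ Real.pi :=
  orthDist_le Real.pi_pos.le (LinearIsometryEquiv.refl ℝ ℂ) fun _ => geoDist_le_pi _ _

/-! ### A quantitative rearrangement inequality -/

/-- The function `h + c u` is nonincreasing in `u` up to `ε`, so the rearrangement inequality
applies to a monotone function within `ε` of it. The remaining term `-c ∑ u (u ∘ τ - u)` equals `c /
2 ∑ (u ∘ τ - u)²`, because `τ` preserves `∑ u²`. -/
theorem sum_mul_perm_sub_ge {ι : Type*} [Fintype ι] (h u : ι → ℝ) (τ : Equiv.Perm ι) {c ε : ℝ}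
    (hh : ∀ j l, u j ≤ u l → c * (u l - u j) - ε ≤ h j - h l) (hε : 0 ≤ ε) :
    c / 2 * ∑ j, (u (τ j) - u j) ^ 2 - ε * ∑ j, |u (τ j) - u j|
      ≤ ∑ j, h j * (u (τ j) - u j) := by
  classical
  set g : ι → ℝ := fun j => h j + c * u j with hg
  set s : ι → Finset ι := fun j => Finset.univ.filter fun l => u j ≤ u l with hs
  have hne : ∀ j, (s j).Nonempty := fun j => ⟨j, by simp [hs]⟩
  -- The running supremum over larger values of `u` is exactly antimonotone along `u`, and exceeds
  -- `g` by at most `ε`.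
  set G : ι → ℝ := fun j => (s j).sup' (hne j) g with hG
  have hGanti : Antivary G u := by
    intro i j hij
    refine Finset.sup'_mono _ ?_ _
    intro l hl
    simp only [hs, Finset.mem_filter, Finset.mem_univ, true_and] at hl ⊢
    exact hij.le.trans hl
  have hGg : ∀ j, |g j - G j| ≤ ε := by
    intro j
    have h1 : g j ≤ G j := Finset.le_sup' g (by simp [hs])
    have h2 : G j ≤ g j + ε := by
      refine Finset.sup'_le _ _ fun l hl => ?_
      simp only [hs, Finset.mem_filter, Finset.mem_univ, true_and] at hl
      have := hh j l hl
      simp only [hg]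
      linarith
    rw [abs_le]
    constructor <;> linarith
  have h1 : 0 ≤ ∑ j, G j * (u (τ j) - u j) := by
    have := hGanti.sum_smul_le_sum_smul_comp_perm (σ := τ)
    simp only [smul_eq_mul] at this
    simp only [mul_sub, Finset.sum_sub_distrib]
    linarith
  have h2 : -(ε * ∑ j, |u (τ j) - u j|) ≤ ∑ j, (g j - G j) * (u (τ j) - u j) := by
    rw [Finset.mul_sum, ← Finset.sum_neg_distrib]
    refine Finset.sum_le_sum fun j _ => ?_
    have : |(g j - G j) * (u (τ j) - u j)| ≤ ε * |u (τ j) - u j| := by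
      rw [abs_mul]; gcongr; exact hGg j
    linarith [neg_abs_le ((g j - G j) * (u (τ j) - u j))]
  have h3 : ∑ j, u j * (u (τ j) - u j) = -(1 / 2 * ∑ j, (u (τ j) - u j) ^ 2) := by
    have : ∑ j, u (τ j) ^ 2 = ∑ j, u j ^ 2 := Equiv.sum_comp τ fun j => u j ^ 2
    have h4 : ∑ j, (u (τ j) - u j) ^ 2
        = ∑ j, u (τ j) ^ 2 - ∑ j, u j ^ 2 - 2 * ∑ j, u j * (u (τ j) - u j) := by
      rw [Finset.mul_sum, ← Finset.sum_sub_distrib, ← Finset.sum_sub_distrib]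
      exact Finset.sum_congr rfl fun j _ => by ring
    linarith
  have h4 : ∑ j, h j * (u (τ j) - u j) = ∑ j, G j * (u (τ j) - u j)
      + ∑ j, (g j - G j) * (u (τ j) - u j) - c * ∑ j, u j * (u (τ j) - u j) := by
    rw [Finset.mul_sum, ← Finset.sum_add_distrib, ← Finset.sum_sub_distrib]
    exact Finset.sum_congr rfl fun j _ => by simp only [hg]; ring
  rw [h4, h3]
  linarith

/-! ### The regular grid -/

/-- Indexing the grid by `ZMod k` makes its rotations available as translations. -/
theorem mem_grid_iff {k : ℕ} [NeZero k] {z : Circle} :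
    z ∈ grid k ↔ ∃ a : ZMod k, z = ZMod.toCircle a := by
  constructor
  · rintro ⟨j, rfl⟩
    refine ⟨((j : ℕ) : ZMod k), ?_⟩
    rw [ZMod.toCircle_eq_circleExp, ZMod.val_natCast_of_lt j.2, mul_div_assoc]
  · rintro ⟨a, rfl⟩
    exact ⟨⟨a.val, a.val_lt⟩, by rw [ZMod.toCircle_eq_circleExp, mul_div_assoc]⟩

/-- The canonical bijection between `Fin k` and `ZMod k`. -/
def finEquivZMod (k : ℕ) [NeZero k] : Fin k ≃ ZMod k where
  toFun j := ((j : ℕ) : ZMod k)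
  invFun a := ⟨a.val, a.val_lt⟩
  left_inv j := by ext; simp [ZMod.val_natCast_of_lt j.2]
  right_inv a := by simp

theorem val_finEquivZMod {k : ℕ} [NeZero k] (j : Fin k) : (finEquivZMod k j).val = j :=
  ZMod.val_natCast_of_lt j.2

theorem mem_regularPositions_iff {ι : Type} [Fintype ι] {k : ℕ} [NeZero k]
    (hk : Fintype.card ι = k) {y : ι → Circle} :
    y ∈ regularPositions ι ↔ ∃ s : ι ≃ ZMod k, ∀ i, y i = ZMod.toCircle (s i) := by
  subst hk
  constructor
  · rintro ⟨σ, hσ⟩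
    refine ⟨σ.trans (finEquivZMod _), fun i => ?_⟩
    rw [hσ i, ZMod.toCircle_eq_circleExp, mul_div_assoc, Equiv.trans_apply, val_finEquivZMod]
  · rintro ⟨s, hs⟩
    refine ⟨s.trans (finEquivZMod _).symm, fun i => ?_⟩
    rw [hs i, ZMod.toCircle_eq_circleExp, mul_div_assoc]
    rfl

theorem finite_regularPositions (ι : Type) [Fintype ι] : (regularPositions ι).Finite := by
  classical
  refine (finite_range fun σ : ι ≃ Fin (Fintype.card ι) => fun i =>
    Circle.exp (2 * Real.pi * (σ i : ℝ) / Fintype.card ι)).subset ?_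
  rintro y ⟨σ, hσ⟩
  exact ⟨σ, (funext hσ).symm⟩

theorem ncard_regularPositions_le (ι : Type) [Fintype ι] :
    (regularPositions ι).ncard ≤ (Fintype.card ι) ^ (Fintype.card ι) := by
  classical
  have h : regularPositions ι ⊆ range fun σ : ι ≃ Fin (Fintype.card ι) => fun i =>
      Circle.exp (2 * Real.pi * (σ i : ℝ) / Fintype.card ι) := by
    rintro y ⟨σ, hσ⟩
    exact ⟨σ, (funext hσ).symm⟩
  refine (ncard_le_ncard h (finite_range _)).trans ?_
  rw [← image_univ]
  refine (ncard_image_le finite_univ).trans ?_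
  rw [ncard_univ, Nat.card_eq_fintype_card, Fintype.card_equiv (Fintype.equivFin ι)]
  exact Nat.factorial_le_pow _

theorem finite_grid (k : ℕ) : (grid k).Finite := by
  refine (finite_range fun j : Fin k => Circle.exp (2 * Real.pi * (j : ℝ) / k)).subset ?_
  rintro z ⟨j, rfl⟩
  exact ⟨j, rfl⟩

theorem ncard_grid_le (k : ℕ) : (grid k).ncard ≤ k := by
  have h : grid k ⊆ range fun j : Fin k => Circle.exp (2 * Real.pi * (j : ℝ) / k) := by
    rintro z ⟨j, rfl⟩
    exact ⟨j, rfl⟩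
  refine (ncard_le_ncard h (finite_range _)).trans ?_
  rw [← image_univ]
  refine (ncard_image_le finite_univ).trans ?_
  rw [ncard_univ, Nat.card_eq_fintype_card, Fintype.card_fin]

theorem geoDist_toCircle {k : ℕ} [NeZero k] (a b : ZMod k) :
    geoDist (ZMod.toCircle a) (ZMod.toCircle b) = geoDist 1 (ZMod.toCircle (b - a)) := by
  rw [← geoDist_mul_left (ZMod.toCircle a) 1, mul_one, ← AddChar.map_add_eq_mul, add_sub_cancel]

/-- Distances on the grid depend only on the difference of indices in `ZMod k`, so translating by
the difference of the indices of the two base points gives the permutation. -/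
theorem exists_perm_geoDist_regularPositions {ι : Type} [Fintype ι] {y y' : ι → Circle}
    (hy : y ∈ regularPositions ι) (hy' : y' ∈ regularPositions ι) (i : ι) :
    ∃ τ : Equiv.Perm ι, ∀ j, geoDist (y' i) (y' j) = geoDist (y i) (y (τ j)) := by
  have : Nonempty ι := ⟨i⟩
  have : NeZero (Fintype.card ι) := ⟨Fintype.card_ne_zero⟩
  obtain ⟨s, hs⟩ := (mem_regularPositions_iff rfl).1 hy
  obtain ⟨s', hs'⟩ := (mem_regularPositions_iff rfl).1 hy'
  refine ⟨s'.trans ((Equiv.addRight (s i - s' i)).trans s.symm), fun j => ?_⟩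
  rw [hs, hs, hs', hs', geoDist_toCircle, geoDist_toCircle]
  simp only [Equiv.trans_apply, Equiv.coe_addRight, Equiv.apply_symm_apply]
  congr 2
  ring

theorem exists_perm_geoDist_grid {ι : Type} [Fintype ι] {k : ℕ} (hk : Fintype.card ι = k)
    {y : ι → Circle} (hy : y ∈ regularPositions ι) {z z' : Circle} (hz : z ∈ grid k)
    (hz' : z' ∈ grid k) :
    ∃ τ : Equiv.Perm ι, ∀ j, geoDist z' (y j) = geoDist z (y (τ j)) := by
  rcases Nat.eq_zero_or_pos k with rfl | hkpos
  · obtain ⟨j, -⟩ := hz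
    exact j.elim0
  have : NeZero k := ⟨hkpos.ne'⟩
  obtain ⟨s, hs⟩ := (mem_regularPositions_iff hk).1 hy
  obtain ⟨a, rfl⟩ := mem_grid_iff.1 hz
  obtain ⟨b, rfl⟩ := mem_grid_iff.1 hz'
  refine ⟨s.trans ((Equiv.addRight (a - b)).trans s.symm), fun j => ?_⟩
  rw [hs, hs, geoDist_toCircle, geoDist_toCircle]
  simp only [Equiv.trans_apply, Equiv.coe_addRight, Equiv.apply_symm_apply]
  congr 2
  ring

theorem exists_mem_grid_geoDist_le {k : ℕ} (hk : 0 < k) (z : Circle) :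
    ∃ g ∈ grid k, geoDist z g ≤ 2 * Real.pi / k := by
  have : NeZero k := ⟨hk.ne'⟩
  have hk' : (0 : ℝ) < k := by exact_mod_cast hk
  have hp := Real.two_pi_pos
  obtain ⟨t, rfl⟩ : ∃ t, Circle.exp t = z := ⟨_, Circle.exp_arg z⟩
  set m : ℤ := ⌊t * k / (2 * Real.pi)⌋ with hm
  have hg : ZMod.toCircle ((m : ℤ) : ZMod k) = Circle.exp (2 * Real.pi / k * m) := by
    ext
    rw [ZMod.toCircle_intCast, Circle.coe_exp]
    congr 1
    push_cast
    ring
  refine ⟨ZMod.toCircle (m : ZMod k), mem_grid_iff.2 ⟨_, rfl⟩, ?_⟩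
  rw [hg]
  refine (geoDist_exp_le _ _).trans ?_
  have h1 := Int.floor_le (t * k / (2 * Real.pi))
  have h2 := Int.lt_floor_add_one (t * k / (2 * Real.pi))
  rw [← hm] at h1 h2
  have h3 : t = 2 * Real.pi / k * (t * k / (2 * Real.pi)) := by field_simp
  have h4 : t - 2 * Real.pi / k * m = 2 * Real.pi / k * (t * k / (2 * Real.pi) - m) := by
    rw [mul_sub, ← h3]
  rw [h4, abs_mul, abs_of_pos (by positivity), abs_of_nonneg (by linarith)]
  calc 2 * Real.pi / k * (t * k / (2 * Real.pi) - m) ≤ 2 * Real.pi / k * 1 := by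
        gcongr; linarith
    _ = _ := mul_one _

/-- Rotation by one grid step permutes the grid and multiplies the sum by the square of the
generator, which differs from `1` once `k ≥ 3`. This vanishing second moment is the only property of
regular tuples used in the geometric lemmas on isotropic tuples. -/
theorem sum_sq_regularPositions {ι : Type} [Fintype ι] (hk : 3 ≤ Fintype.card ι) {y : ι → Circle}
    (hy : y ∈ regularPositions ι) : ∑ i, (y i : ℂ) ^ 2 = 0 := by
  set k := Fintype.card ι with hk'
  have : NeZero k := ⟨by omega⟩
  obtain ⟨s, hs⟩ := (mem_regularPositions_iff hk'.symm).1 hy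
  have h1 : ∑ i, (y i : ℂ) ^ 2 = ∑ a : ZMod k, (ZMod.toCircle a : ℂ) ^ 2 := by
    rw [← Equiv.sum_comp s]
    simp [hs]
  have h2 : (ZMod.toCircle (1 : ZMod k) : ℂ) ^ 2 * ∑ a : ZMod k, (ZMod.toCircle a : ℂ) ^ 2
      = ∑ a : ZMod k, (ZMod.toCircle a : ℂ) ^ 2 := by
    conv_rhs => rw [← Equiv.sum_comp (Equiv.addLeft (1 : ZMod k))]
    rw [Finset.mul_sum]
    refine Finset.sum_congr rfl fun a _ => ?_
    rw [Equiv.coe_addLeft, AddChar.map_add_eq_mul, Circle.coe_mul, mul_pow]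
  have h3 : (ZMod.toCircle (1 : ZMod k) : ℂ) ^ 2 ≠ 1 := by
    intro h
    have h4 : ZMod.toCircle (1 + 1 : ZMod k) = ZMod.toCircle (0 : ZMod k) := by
      ext
      rw [AddChar.map_add_eq_mul, AddChar.map_zero_eq_one, Circle.coe_mul, ← sq, h, Circle.coe_one]
    have h5 := ZMod.injective_toCircle h4
    have h6 : ((2 : ℕ) : ZMod k) = 0 := by rw [← h5]; norm_num
    rw [ZMod.natCast_eq_zero_iff] at h6
    have := Nat.le_of_dvd (by norm_num) h6
    omega
  rw [h1]
  have h4 : ((ZMod.toCircle (1 : ZMod k) : ℂ) ^ 2 - 1)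
      * ∑ a : ZMod k, (ZMod.toCircle a : ℂ) ^ 2 = 0 := by
    rw [sub_mul, h2, one_mul, sub_self]
  exact (mul_eq_zero.1 h4).resolve_left (sub_ne_zero.2 h3)

/-! ### Isotropic tuples -/

theorem coe_mul_star (z : Circle) : (z : ℂ) * star (z : ℂ) = 1 := by
  have := Complex.mul_conj (z : ℂ)
  rw [Complex.normSq_eq_norm_sq, Circle.norm_coe] at this
  simpa using this

/-- Write `(Re w)² = |w|² / 2 + Re (w²) / 2`; the second part sums to zero by isotropy. -/
theorem sum_sq_inner {ι : Type*} [Fintype ι] {y : ι → Circle} (hy : ∑ i, (y i : ℂ) ^ 2 = 0)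
    (v : ℂ) : ∑ i, (v * star (y i : ℂ)).re ^ 2 = Fintype.card ι / 2 * ‖v‖ ^ 2 := by
  have h1 : ∀ i, (v * star (y i : ℂ)).re ^ 2
      = 1 / 2 * ‖v‖ ^ 2 + 1 / 2 * (star v ^ 2 * (y i : ℂ) ^ 2).re := by
    intro i
    have h : ‖v‖ ^ 2 = (v * star (y i : ℂ)).re ^ 2 + (v * star (y i : ℂ)).im ^ 2 := by
      rw [← sub_eq_iff_eq_add', Complex.sq_norm_sub_sq_re (v * star (y i : ℂ)) |>.symm]
      simp [Circle.norm_coe]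
    have h' : (star v ^ 2 * (y i : ℂ) ^ 2) = star (v * star (y i : ℂ)) ^ 2 := by
      rw [star_mul, star_star]; ring
    rw [h', h]
    generalize v * star (y i : ℂ) = w
    simp only [sq, Complex.mul_re, Complex.star_def, Complex.conj_re, Complex.conj_im]
    ring
  simp_rw [h1]
  rw [Finset.sum_add_distrib, ← Finset.mul_sum, ← Finset.mul_sum, ← Complex.re_sum,
    ← Finset.mul_sum, hy]
  simp
  ring

/-- With each cosine written as the real part of a product, the expansion contains the vanishing
second moments, the constants, and the correlations of `y` with `x` and with its conjugate. -/
theorem sum_sq_cos_sub {ι : Type*} [Fintype ι] {x y : ι → Circle} (hx : ∑ i, (x i : ℂ) ^ 2 = 0)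
    (hy : ∑ i, (y i : ℂ) ^ 2 = 0) :
    ∑ i, ∑ j, (Real.cos (geoDist (y i) (y j)) - Real.cos (geoDist (x i) (x j))) ^ 2
      = (Fintype.card ι : ℝ) ^ 2 - ‖∑ i, (y i : ℂ) * star (x i : ℂ)‖ ^ 2
        - ‖∑ i, (y i : ℂ) * x i‖ ^ 2 := by
  set a := ∑ i, (y i : ℂ) * star (x i : ℂ) with ha
  set b := ∑ i, (y i : ℂ) * x i with hb
  have hsa : star a = ∑ i, star (y i : ℂ) * x i := by
    rw [ha, star_sum]; simp [mul_comm]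
  have hsb : star b = ∑ i, star (y i : ℂ) * star (x i : ℂ) := by
    rw [hb, star_sum]; simp [mul_comm]
  have hsx : ∑ i, star (x i : ℂ) ^ 2 = 0 := by
    simpa using congrArg star hx
  have hsy : ∑ i, star (y i : ℂ) ^ 2 = 0 := by
    simpa using congrArg star hy
  have hre : ∀ w : ℂ, ((w.re : ℝ) : ℂ) = (w + star w) / 2 := fun w => Complex.re_eq_add_conj w
  have hn : ∀ w : ℂ, ((‖w‖ ^ 2 : ℝ) : ℂ) = w * star w := fun w => by
    rw [Complex.star_def, Complex.mul_conj, Complex.normSq_eq_norm_sq]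
  have key : ∀ i j : ι,
      (((Real.cos (geoDist (y i) (y j)) - Real.cos (geoDist (x i) (x j))) ^ 2 : ℝ) : ℂ)
      = 1 / 4 * ((y i : ℂ) ^ 2 * star (y j : ℂ) ^ 2) + 1 / 4 * (star (y i : ℂ) ^ 2 * (y j : ℂ) ^ 2)
        + 1 / 4 * ((x i : ℂ) ^ 2 * star (x j : ℂ) ^ 2)
        + 1 / 4 * (star (x i : ℂ) ^ 2 * (x j : ℂ) ^ 2) + 1
        - 1 / 2 * (((y i : ℂ) * x i) * (star (y j : ℂ) * star (x j : ℂ)))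
        - 1 / 2 * (((y i : ℂ) * star (x i : ℂ)) * (star (y j : ℂ) * x j))
        - 1 / 2 * ((star (y i : ℂ) * x i) * ((y j : ℂ) * star (x j : ℂ)))
        - 1 / 2 * ((star (y i : ℂ) * star (x i : ℂ)) * ((y j : ℂ) * x j)) := by
    intro i j
    rw [cos_geoDist, cos_geoDist]
    push_cast
    rw [hre, hre]
    simp only [star_mul, star_star]
    linear_combination (1 / 2) * coe_mul_star (y i) * (y j * star (y j : ℂ))
      + (1 / 2) * coe_mul_star (y j) + (1 / 2) * coe_mul_star (x i) * (x j * star (x j : ℂ))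
      + (1 / 2) * coe_mul_star (x j)
  apply Complex.ofReal_injective
  rw [Complex.ofReal_sum]
  simp_rw [Complex.ofReal_sum, key, Finset.sum_sub_distrib, Finset.sum_add_distrib,
    ← Finset.mul_sum, ← Finset.sum_mul]
  rw [hx, hy, hsx, hsy, ← hsa, ← hsb, ← ha, ← hb]
  simp only [Finset.sum_const, Finset.card_univ, nsmul_eq_mul]
  rw [Complex.ofReal_sub, Complex.ofReal_sub, hn, hn]
  push_cast
  ring

/-- Apply `|∑ r²| ≤ ∑ |r|²` to the residual `r = k y - a x - b x̄` of the regression of `y` on `x`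
and its conjugate. Isotropy makes both sides explicit, and the result is `(|a| + |b|)² ≤ k²`. -/
theorem norm_sum_add_norm_sum_le {ι : Type*} [Fintype ι] {x y : ι → Circle}
    (hx : ∑ i, (x i : ℂ) ^ 2 = 0) (hy : ∑ i, (y i : ℂ) ^ 2 = 0) :
    ‖∑ i, (y i : ℂ) * star (x i : ℂ)‖ + ‖∑ i, (y i : ℂ) * x i‖ ≤ Fintype.card ι := by
  rcases isEmpty_or_nonempty ι with hι | hι
  · simp
  set a := ∑ i, (y i : ℂ) * star (x i : ℂ) with ha
  set b := ∑ i, (y i : ℂ) * x i with hb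
  set k : ℝ := (Fintype.card ι : ℝ) with hk
  have hkpos : 0 < k := by rw [hk]; exact_mod_cast Fintype.card_pos
  have hsa : star a = ∑ i, star (y i : ℂ) * x i := by
    rw [ha, star_sum]; simp [mul_comm]
  have hsb : star b = ∑ i, star (y i : ℂ) * star (x i : ℂ) := by
    rw [hb, star_sum]; simp [mul_comm]
  have hsx : ∑ i, star (x i : ℂ) ^ 2 = 0 := by
    simpa using congrArg star hx
  have hn : ∀ w : ℂ, ((‖w‖ ^ 2 : ℝ) : ℂ) = w * star w := fun w => by
    rw [Complex.star_def, Complex.mul_conj, Complex.normSq_eq_norm_sq]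
  set r : ι → ℂ := fun j => k * y j - a * x j - b * star (x j : ℂ) with hr
  have h1 : ∑ j, r j ^ 2 = -(2 * k * (a * b)) := by
    have : ∀ j, r j ^ 2 = (k : ℂ) ^ 2 * (y j : ℂ) ^ 2 + a ^ 2 * (x j : ℂ) ^ 2
        + b ^ 2 * star (x j : ℂ) ^ 2 + 2 * a * b
        - 2 * k * a * ((y j : ℂ) * x j) - 2 * k * b * ((y j : ℂ) * star (x j : ℂ)) := by
      intro j
      simp only [hr]
      linear_combination (2 * a * b) * coe_mul_star (x j)
    simp_rw [this, Finset.sum_sub_distrib, Finset.sum_add_distrib, ← Finset.mul_sum]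
    rw [hx, hy, hsx, ← ha, ← hb]
    simp only [Finset.sum_const, Finset.card_univ, nsmul_eq_mul, hk]
    push_cast
    ring
  have h2 : ∑ j, ‖r j‖ ^ 2 = k ^ 3 - k * (‖a‖ ^ 2 + ‖b‖ ^ 2) := by
    have : ∀ j, ((‖r j‖ ^ 2 : ℝ) : ℂ) = (k : ℂ) ^ 2 + a * star a + b * star b
        + a * star b * (x j : ℂ) ^ 2 + star a * b * star (x j : ℂ) ^ 2
        - k * star a * ((y j : ℂ) * star (x j : ℂ)) - k * star b * ((y j : ℂ) * x j)
        - k * a * (star (y j : ℂ) * x j) - k * b * (star (y j : ℂ) * star (x j : ℂ)) := by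
      intro j
      rw [hn]
      simp only [hr, star_sub, star_mul, star_star]
      have hks : star (k : ℂ) = k := Complex.conj_ofReal k
      rw [hks]
      linear_combination (k : ℂ) ^ 2 * coe_mul_star (y j)
        + (a * star a + b * star b) * coe_mul_star (x j)
    apply Complex.ofReal_injective
    rw [Complex.ofReal_sum]
    simp_rw [this, Finset.sum_sub_distrib, Finset.sum_add_distrib, ← Finset.mul_sum]
    rw [hx, hsx, ← hsa, ← hsb, ← ha, ← hb]
    simp only [Finset.sum_const, Finset.card_univ, nsmul_eq_mul]
    rw [Complex.ofReal_sub, Complex.ofReal_mul, Complex.ofReal_add, hn, hn, hk]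
    push_cast
    ring
  have h3 : 2 * k * (‖a‖ * ‖b‖) ≤ k ^ 3 - k * (‖a‖ ^ 2 + ‖b‖ ^ 2) := by
    rw [← h2]
    calc 2 * k * (‖a‖ * ‖b‖) = ‖∑ j, r j ^ 2‖ := by
          rw [h1, norm_neg, norm_mul, norm_mul, norm_mul, Complex.norm_real, Real.norm_eq_abs,
            abs_of_pos hkpos]
          simp
      _ ≤ ∑ j, ‖r j ^ 2‖ := norm_sum_le _ _
      _ = _ := by simp
  have h4 : (‖a‖ + ‖b‖) ^ 2 ≤ k ^ 2 := by
    have : k * (‖a‖ + ‖b‖) ^ 2 ≤ k * k ^ 2 := by nlinarith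
    exact le_of_mul_le_mul_left this hkpos
  exact (pow_le_pow_iff_left₀ (by positivity) hkpos.le two_ne_zero).1 h4

theorem exists_circle_norm_mul (a : ℂ) : ∃ u : Circle, (a * star (u : ℂ)).re = ‖a‖ := by
  rcases eq_or_ne a 0 with rfl | ha
  · exact ⟨1, by simp⟩
  · refine ⟨⟨a / ‖a‖, by simp [Submonoid.unitSphere, ha]⟩, ?_⟩
    have hn : (‖a‖ : ℂ) ≠ 0 := by simpa using ha
    have : a * star (a / ‖a‖) = ((‖a‖ : ℝ) : ℂ) := by
      rw [star_div₀, Complex.star_def, Complex.conj_ofReal, mul_div_assoc', Complex.mul_conj,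
        Complex.normSq_eq_norm_sq]
      push_cast
      field_simp
    change (a * star (a / ‖a‖)).re = ‖a‖
    rw [this, Complex.ofReal_re]

theorem sum_norm_sub_sq {ι : Type*} [Fintype ι] (x y : ι → Circle) :
    ∑ i, ‖(x i : ℂ) - y i‖ ^ 2
      = 2 * Fintype.card ι - 2 * (∑ i, (y i : ℂ) * star (x i : ℂ)).re := by
  simp_rw [norm_sub_sq_eq_cos, fun i => geoDist_comm (x i) (y i), cos_geoDist]
  rw [Finset.sum_sub_distrib, ← Finset.mul_sum, Complex.re_sum]
  simp
  ring

/-- Two isotropic tuples with close Gram matrices are close up to an orthogonal transformation. -/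
theorem exists_orth_sum_norm_sub_sq_le {ι : Type*} [Fintype ι] [Nonempty ι] {x y : ι → Circle}
    (hx : ∑ i, (x i : ℂ) ^ 2 = 0) (hy : ∑ i, (y i : ℂ) ^ 2 = 0) :
    ∃ Q : Orth, ∑ i, ‖(rot Q (x i) : ℂ) - y i‖ ^ 2 ≤ 2 / Fintype.card ι *
      ∑ i, ∑ j, (Real.cos (geoDist (y i) (y j)) - Real.cos (geoDist (x i) (x j))) ^ 2 := by
  rw [sum_sq_cos_sub hx hy]
  have hle := norm_sum_add_norm_sum_le hx hy
  set a := ∑ i, (y i : ℂ) * star (x i : ℂ) with ha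
  set b := ∑ i, (y i : ℂ) * x i with hb
  set k : ℝ := (Fintype.card ι : ℝ) with hk
  have hkpos : 0 < k := by rw [hk]; exact_mod_cast Fintype.card_pos
  have ha0 := norm_nonneg a
  have hb0 := norm_nonneg b
  -- Used with `m = max |a| |b|`: then `|a|² + |b|² ≤ (|a| + |b|) m ≤ k m`, and `2k - 2m` is the
  -- squared error after the best rotation, or after the best reflection.
  have hmain : ∀ m : ℝ, ‖a‖ ^ 2 + ‖b‖ ^ 2 ≤ k * m →
      2 * k - 2 * m ≤ 2 / k * (k ^ 2 - ‖a‖ ^ 2 - ‖b‖ ^ 2) := by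
    intro m hm
    have h : 2 * k - 2 * m = 2 / k * (k ^ 2 - k * m) := by field_simp
    rw [h]
    exact mul_le_mul_of_nonneg_left (by linarith) (by positivity)
  rcases le_total ‖b‖ ‖a‖ with h | h
  · obtain ⟨u, hu⟩ := exists_circle_norm_mul a
    refine ⟨rotation u, ?_⟩
    have h1 : ∑ i, (y i : ℂ) * star (rot (rotation u) (x i) : ℂ) = a * star (u : ℂ) := by
      rw [ha, Finset.sum_mul]
      refine Finset.sum_congr rfl fun i _ => ?_
      rw [coe_rot, rotation_apply, star_mul]
      ring
    rw [sum_norm_sub_sq, h1, hu]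
    exact hmain _ (by nlinarith)
  · obtain ⟨u, hu⟩ := exists_circle_norm_mul b
    refine ⟨Complex.conjLIE.trans (rotation u), ?_⟩
    have h1 : ∑ i, (y i : ℂ) * star (rot (Complex.conjLIE.trans (rotation u)) (x i) : ℂ)
        = b * star (u : ℂ) := by
      rw [hb, Finset.sum_mul]
      refine Finset.sum_congr rfl fun i _ => ?_
      rw [coe_rot, LinearIsometryEquiv.trans_apply, rotation_apply, star_mul,
        Complex.conjLIE_apply, Complex.star_def, Complex.conj_conj]
      simp only [mul_assoc]
    rw [sum_norm_sub_sq, h1, hu]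
    exact hmain _ (by nlinarith)

/-! ### Deterministic analysis of the two localization steps -/

theorem IsBiLipschitz.abs_sub_le {n : ℕ} {cl cL ce : ℝ} {f : Circle → Circle → ℝ}
    (hf : IsBiLipschitz n cl cL ce f) (x x' y y' : Circle) :
    |f x y - f x' y'| ≤ cL * (geoDist x x' + geoDist y y') + 2 * (ce * √(Real.log n / n)) := by
  have h1 := hf.upper x y y'
  have h2 := hf.upper y' x x'
  rw [hf.symm y' x, hf.symm y' x'] at h2
  have h3 := _root_.abs_sub_le (f x y) (f x y') (f x' y')
  linarith

theorem sum_abs_le_sqrt {ι : Type*} (s : Finset ι) (g : ι → ℝ) :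
    ∑ i ∈ s, |g i| ≤ √(s.card) * √(∑ i ∈ s, g i ^ 2) := by
  rw [← Real.sqrt_mul (by positivity)]
  apply Real.le_sqrt_of_sq_le
  have := sq_sum_le_card_mul_sum_sq (s := s) (f := fun i => |g i|)
  simpa using this

theorem neg_mul_sum_abs_le {ι : Type*} (s : Finset ι) (g b : ι → ℝ) {δ : ℝ}
    (h : ∀ i ∈ s, |g i| ≤ δ) : -(δ * ∑ i ∈ s, |b i|) ≤ ∑ i ∈ s, g i * b i := by
  rw [Finset.mul_sum, ← Finset.sum_neg_distrib]
  refine Finset.sum_le_sum fun i hi => ?_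
  have : |g i * b i| ≤ δ * |b i| := by
    rw [abs_mul]
    exact mul_le_mul_of_nonneg_right (h i hi) (abs_nonneg _)
  linarith [neg_abs_le (g i * b i)]

/-- Bound on the distortion of the pairwise distances in the initial localization step. -/
theorem sqrt_sum_geoDist_sub_sq_le {ι : Type} [Fintype ι] {n : ℕ} {cl cL ce : ℝ}
    {f : Circle → Circle → ℝ} (hf : IsBiLipschitz n cl cL ce f) (hcl : 0 < cl) (hcL : 0 ≤ cL)
    (hce : 0 ≤ ce) {x xr xh : ι → Circle} {ρ t : ℝ} (ht : 0 ≤ t) (hρ : 0 ≤ ρ)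
    (hxr : xr ∈ regularPositions ι) (hx : ∀ i, geoDist (x i) (xr i) ≤ ρ) {M : ι → ι → ℝ}
    (hxh : xh ∈ regularPositions ι)
    (hmin : IsMinOn (fun y : ι → Circle => ∑ i, ∑ j, M i j * geoDist (y i) (y j))
      (regularPositions ι) xh)
    (hnoise : -(t * √(∑ i, ∑ j, (geoDist (xh i) (xh j) - geoDist (xr i) (xr j)) ^ 2))
      ≤ ∑ i, ∑ j, (M i j - f (x i) (x j)) * (geoDist (xh i) (xh j) - geoDist (xr i) (xr j))) :
    √(∑ i, ∑ j, (geoDist (xh i) (xh j) - geoDist (xr i) (xr j)) ^ 2)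
      ≤ 2 / cl * ((2 * cL * ρ + 3 * (ce * √(Real.log n / n))) * Fintype.card ι + t) := by
  set ε := ce * √(Real.log n / n) with hε
  have hε0 : 0 ≤ ε := by positivity
  set Δ : ι → ι → ℝ := fun i j => geoDist (xh i) (xh j) - geoDist (xr i) (xr j) with hΔ
  set k : ℝ := (Fintype.card ι : ℝ) with hk
  set V := √(∑ i, ∑ j, Δ i j ^ 2) with hV
  have hV0 : 0 ≤ V := Real.sqrt_nonneg _
  have hVsq : ∑ i, ∑ j, Δ i j ^ 2 = V ^ 2 := by
    rw [hV, Real.sq_sqrt (Finset.sum_nonneg fun i _ => Finset.sum_nonneg fun j _ => sq_nonneg _)]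
  have hL1 : ∑ i, ∑ j, |Δ i j| ≤ k * V := by
    have := sum_abs_le_sqrt (Finset.univ : Finset (ι × ι)) fun p => Δ p.1 p.2
    rw [Fintype.sum_prod_type, Fintype.sum_prod_type] at this
    refine this.trans (le_of_eq ?_)
    rw [Finset.card_univ, Fintype.card_prod]
    push_cast
    rw [Real.sqrt_mul_self (by positivity)]
  have hmin' : ∑ i, ∑ j, M i j * Δ i j ≤ 0 := by
    have := isMinOn_iff.1 hmin xr hxr
    simp only [hΔ, mul_sub, Finset.sum_sub_distrib]
    linarith
  -- Row by row: the distances from `xh i` are a permutation of those from `xr i`.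
  have hsig : cl / 2 * V ^ 2 - ε * ∑ i, ∑ j, |Δ i j|
      ≤ ∑ i, ∑ j, f (xr i) (xr j) * Δ i j := by
    rw [← hVsq, Finset.mul_sum, Finset.mul_sum, ← Finset.sum_sub_distrib]
    refine Finset.sum_le_sum fun i _ => ?_
    obtain ⟨τ, hτ⟩ := exists_perm_geoDist_regularPositions hxr hxh i
    have h := sum_mul_perm_sub_ge (fun j => f (xr i) (xr j)) (fun j => geoDist (xr i) (xr j)) τ
      (c := cl) (ε := ε) (fun j l hjl => hf.lower _ _ _ hjl) hε0
    simp only [← hτ] at h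
    exact h
  -- Price of evaluating `f` at the regular tuple instead of the latent points: each of the two
  -- arguments moves by at most `ρ`.
  have happ : -((2 * cL * ρ + 2 * ε) * ∑ i, ∑ j, |Δ i j|)
      ≤ ∑ i, ∑ j, (f (x i) (x j) - f (xr i) (xr j)) * Δ i j := by
    rw [Finset.mul_sum, ← Finset.sum_neg_distrib]
    refine Finset.sum_le_sum fun i _ => ?_
    refine neg_mul_sum_abs_le _ _ _ fun j _ => (hf.abs_sub_le _ _ _ _).trans ?_
    have : cL * (geoDist (x i) (xr i) + geoDist (x j) (xr j)) ≤ cL * (ρ + ρ) := by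
      gcongr <;> exact hx _
    linarith
  have hsplit : ∑ i, ∑ j, M i j * Δ i j = ∑ i, ∑ j, (M i j - f (x i) (x j)) * Δ i j
      + ∑ i, ∑ j, (f (x i) (x j) - f (xr i) (xr j)) * Δ i j
      + ∑ i, ∑ j, f (xr i) (xr j) * Δ i j := by
    simp only [← Finset.sum_add_distrib]
    exact Finset.sum_congr rfl fun i _ => Finset.sum_congr rfl fun j _ => by ring
  have hfin : cl / 2 * V ^ 2 ≤ ((2 * cL * ρ + 3 * ε) * k + t) * V := by
    have h5 : (2 * cL * ρ + 3 * ε) * ∑ i, ∑ j, |Δ i j| ≤ (2 * cL * ρ + 3 * ε) * (k * V) := by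
      gcongr
    linarith
  rcases hV0.eq_or_lt with h0 | h0
  · rw [← h0]
    positivity
  · have h6 : cl / 2 * V ≤ (2 * cL * ρ + 3 * ε) * k + t :=
      le_of_mul_le_mul_right (by linarith [hfin]) h0
    calc V = 2 / cl * (cl / 2 * V) := by field_simp
      _ ≤ _ := by gcongr

/-- The initial localization step recovers the positions in average, up to an orthogonal
transformation. -/
theorem exists_orth_sum_geoDist_le {ι : Type} [Fintype ι] (hk : 3 ≤ Fintype.card ι) {n : ℕ}
    {cl cL ce : ℝ} {f : Circle → Circle → ℝ} (hf : IsBiLipschitz n cl cL ce f) (hcl : 0 < cl)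
    (hcL : 0 ≤ cL) (hce : 0 ≤ ce) {x xr xh : ι → Circle} {ρ t : ℝ} (ht : 0 ≤ t) (hρ : 0 ≤ ρ)
    (hxr : xr ∈ regularPositions ι) (hx : ∀ i, geoDist (x i) (xr i) ≤ ρ) {M : ι → ι → ℝ}
    (hxh : xh ∈ regularPositions ι)
    (hmin : IsMinOn (fun y : ι → Circle => ∑ i, ∑ j, M i j * geoDist (y i) (y j))
      (regularPositions ι) xh)
    (hnoise : -(t * √(∑ i, ∑ j, (geoDist (xh i) (xh j) - geoDist (xr i) (xr j)) ^ 2))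
      ≤ ∑ i, ∑ j, (M i j - f (x i) (x j)) * (geoDist (xh i) (xh j) - geoDist (xr i) (xr j))) :
    ∃ Q : Orth, ∑ j, geoDist (rot Q (x j)) (xh j) ≤ Fintype.card ι * ρ +
      2 * Real.pi / cl * ((2 * cL * ρ + 3 * (ce * √(Real.log n / n))) * Fintype.card ι + t) := by
  have : Nonempty ι := Fintype.card_pos_iff.1 (by omega)
  have hkpos : (0 : ℝ) < Fintype.card ι := by exact_mod_cast (by omega : 0 < Fintype.card ι)
  have hV := sqrt_sum_geoDist_sub_sq_le hf hcl hcL hce ht hρ hxr hx hxh hmin hnoise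
  set V := √(∑ i, ∑ j, (geoDist (xh i) (xh j) - geoDist (xr i) (xr j)) ^ 2) with hVdef
  obtain ⟨Q, hQ⟩ := exists_orth_sum_norm_sub_sq_le (sum_sq_regularPositions hk hxr)
    (sum_sq_regularPositions hk hxh)
  refine ⟨Q, ?_⟩
  have hgram : ∑ i, ∑ j, (Real.cos (geoDist (xh i) (xh j)) - Real.cos (geoDist (xr i) (xr j))) ^ 2
      ≤ V ^ 2 := by
    rw [hVdef, Real.sq_sqrt (Finset.sum_nonneg fun i _ => Finset.sum_nonneg fun j _ => sq_nonneg _)]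
    refine Finset.sum_le_sum fun i _ => Finset.sum_le_sum fun j _ => ?_
    rw [sq_le_sq]
    exact Real.abs_cos_sub_cos_le _ _
  have hnorm : ∑ i, ‖(rot Q (xr i) : ℂ) - xh i‖ ≤ 2 * V := by
    have h1 := sum_abs_le_sqrt Finset.univ fun i => ‖(rot Q (xr i) : ℂ) - xh i‖
    simp only [abs_norm] at h1
    refine h1.trans ?_
    rw [← Real.sqrt_mul (by positivity), Finset.card_univ]
    apply Real.sqrt_le_iff.2 ⟨by positivity, ?_⟩
    calc (Fintype.card ι : ℝ) * ∑ i, ‖(rot Q (xr i) : ℂ) - xh i‖ ^ 2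
        ≤ Fintype.card ι * (2 / Fintype.card ι * V ^ 2) := by
          gcongr
          exact hQ.trans (by gcongr)
      _ = 2 * V ^ 2 := by field_simp
      _ ≤ (2 * V) ^ 2 := by nlinarith [sq_nonneg V]
  have h2 : ∑ j, geoDist (rot Q (x j)) (xh j)
      ≤ ∑ _j : ι, ρ + ∑ j, Real.pi / 2 * ‖(rot Q (xr j) : ℂ) - xh j‖ := by
    rw [← Finset.sum_add_distrib]
    refine Finset.sum_le_sum fun j _ => ?_
    refine (geoDist_triangle _ (rot Q (xr j)) _).trans ?_
    rw [geoDist_rot]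
    exact add_le_add (hx j) (geoDist_le_norm_sub _ _)
  rw [← Finset.mul_sum, Finset.sum_const, Finset.card_univ, nsmul_eq_mul] at h2
  have hp := Real.pi_pos
  calc _ ≤ _ := h2
    _ ≤ Fintype.card ι * ρ + Real.pi / 2 * (2 * V) := by gcongr
    _ = Fintype.card ι * ρ + Real.pi * V := by ring
    _ ≤ Fintype.card ι * ρ + Real.pi * (2 / cl * ((2 * cL * ρ +
        3 * (ce * √(Real.log n / n))) * Fintype.card ι + t)) := by gcongr
    _ = _ := by ring

/-- The refinement step recovers the position of a single point. -/
theorem geoDist_refined_le {ι : Type} [Fintype ι] {k : ℕ} (hcard : Fintype.card ι = k)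
    (hk : 3 ≤ k) {n : ℕ} {cl cL ce : ℝ} {f : Circle → Circle → ℝ}
    (hf : IsBiLipschitz n cl cL ce f) (hcl : 0 < cl) (hcL : 0 ≤ cL) (hce : 0 ≤ ce)
    {x xh : ι → Circle} (hxh : xh ∈ regularPositions ι) {Q : Orth} {D t : ℝ} (ht : 0 ≤ t)
    (hD : ∑ j, geoDist (rot Q (x j)) (xh j) ≤ D) {w zh : Circle} {M : ι → ℝ} (hzh : zh ∈ grid k)
    (hmin : IsMinOn (fun z => ∑ j, M j * geoDist z (xh j)) (grid k) zh)
    (hnoise : ∀ z ∈ grid k, -(t * √(∑ j, (geoDist zh (xh j) - geoDist z (xh j)) ^ 2))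
      ≤ ∑ j, (M j - f w (x j)) * (geoDist zh (xh j) - geoDist z (xh j))) :
    geoDist zh (rot Q w) ≤ 2 * Real.pi / k + Real.pi ^ 2 / (cl * k) *
      (t * √k + cL * (2 * Real.pi) + cL * D + 3 * (ce * √(Real.log n / n)) * k) := by
  set ε := ce * √(Real.log n / n) with hε
  have hε0 : 0 ≤ ε := by positivity
  have hkpos : (0 : ℝ) < k := by exact_mod_cast (by omega : 0 < k)
  have hp := Real.pi_pos
  have hD0 : 0 ≤ D := (Finset.sum_nonneg fun j _ => geoDist_nonneg _ _).trans hD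
  -- The competitor is a grid point next to the aligned target; the criterion is minimized over the
  -- grid only.
  obtain ⟨z, hz, hzw⟩ := exists_mem_grid_geoDist_le (by omega : 0 < k) (rot Q w)
  set r := geoDist zh z with hr
  have hr0 : 0 ≤ r := geoDist_nonneg _ _
  set b : ι → ℝ := fun j => geoDist zh (xh j) - geoDist z (xh j) with hb
  have hbr : ∀ j, |b j| ≤ r := fun j => abs_geoDist_sub_le _ _ _
  have hb1 : ∑ j, |b j| ≤ k * r := by
    calc ∑ j, |b j| ≤ ∑ _j : ι, r := Finset.sum_le_sum fun j _ => hbr j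
      _ = k * r := by rw [Finset.sum_const, Finset.card_univ, hcard, nsmul_eq_mul]
  have hb2 : √(∑ j, b j ^ 2) ≤ √k * r := by
    rw [← Real.sqrt_sq hr0, ← Real.sqrt_mul hkpos.le]
    apply Real.sqrt_le_sqrt
    calc ∑ j, b j ^ 2 ≤ ∑ _j : ι, r ^ 2 := Finset.sum_le_sum fun j _ => by
          rw [← sq_abs]; exact pow_le_pow_left₀ (abs_nonneg _) (hbr j) 2
      _ = k * r ^ 2 := by rw [Finset.sum_const, Finset.card_univ, hcard, nsmul_eq_mul]
  -- Curvature of the criterion: distance differences dominate cosine differences, whose squares sum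
  -- to `k / 2 ‖zh - z‖²` by isotropy.
  have hlow : 2 * k / Real.pi ^ 2 * r ^ 2 ≤ ∑ j, b j ^ 2 := by
    have h1 := sum_sq_inner (sum_sq_regularPositions (hcard.symm ▸ hk) hxh) ((zh : ℂ) - z)
    rw [hcard] at h1
    calc 2 * k / Real.pi ^ 2 * r ^ 2
        ≤ 2 * k / Real.pi ^ 2 * (Real.pi / 2 * ‖(zh : ℂ) - z‖) ^ 2 := by
          gcongr
          exact geoDist_le_norm_sub _ _
      _ = k / 2 * ‖(zh : ℂ) - z‖ ^ 2 := by field_simp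
      _ = ∑ j, (((zh : ℂ) - z) * star (xh j : ℂ)).re ^ 2 := h1.symm
      _ ≤ ∑ j, b j ^ 2 := by
          refine Finset.sum_le_sum fun j _ => ?_
          rw [sub_mul, Complex.sub_re, ← cos_geoDist, ← cos_geoDist, sq_le_sq]
          exact Real.abs_cos_sub_cos_le _ _
  have hmin' : ∑ j, M j * b j ≤ 0 := by
    have := isMinOn_iff.1 hmin z hz
    simp only [hb, mul_sub, Finset.sum_sub_distrib]
    linarith
  have hsig : cl / 2 * ∑ j, b j ^ 2 - ε * ∑ j, |b j|
      ≤ ∑ j, f (rot Q.symm z) (rot Q.symm (xh j)) * b j := by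
    obtain ⟨τ, hτ⟩ := exists_perm_geoDist_grid hcard hxh hz hzh
    have h := sum_mul_perm_sub_ge (fun j => f (rot Q.symm z) (rot Q.symm (xh j)))
      (fun j => geoDist z (xh j)) τ (c := cl) (ε := ε) (fun j l hjl => by
        have := hf.lower (rot Q.symm z) (rot Q.symm (xh l)) (rot Q.symm (xh j))
        rw [geoDist_rot, geoDist_rot] at this
        exact this hjl) hε0
    simp only [← hτ] at h
    exact h
  -- Every weight is at most `r`, so the initial errors enter through their sum `D` alone and no
  -- uniform control of them is needed.
  have happ : -((cL * (2 * Real.pi) + cL * D + 2 * ε * k) * r)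
      ≤ ∑ j, (f w (x j) - f (rot Q.symm z) (rot Q.symm (xh j))) * b j := by
    have h1 : ∀ j, -((cL * (2 * Real.pi / k + geoDist (rot Q (x j)) (xh j)) + 2 * ε) * r)
        ≤ (f w (x j) - f (rot Q.symm z) (rot Q.symm (xh j))) * b j := by
      intro j
      have h2 : |f w (x j) - f (rot Q.symm z) (rot Q.symm (xh j))|
          ≤ cL * (2 * Real.pi / k + geoDist (rot Q (x j)) (xh j)) + 2 * ε := by
        refine (hf.abs_sub_le _ _ _ _).trans ?_
        rw [← geoDist_rot_left, ← geoDist_rot_left]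
        gcongr
      have h3 : |(f w (x j) - f (rot Q.symm z) (rot Q.symm (xh j))) * b j|
          ≤ (cL * (2 * Real.pi / k + geoDist (rot Q (x j)) (xh j)) + 2 * ε) * r := by
        rw [abs_mul]
        exact mul_le_mul h2 (hbr j) (abs_nonneg _) ((abs_nonneg _).trans h2)
      linarith [neg_abs_le ((f w (x j) - f (rot Q.symm z) (rot Q.symm (xh j))) * b j)]
    refine le_trans ?_ (Finset.sum_le_sum fun j _ => h1 j)
    rw [Finset.sum_neg_distrib, ← Finset.sum_mul, neg_le_neg_iff, Finset.sum_add_distrib,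
      ← Finset.mul_sum, Finset.sum_add_distrib]
    simp only [Finset.sum_const, Finset.card_univ, hcard, nsmul_eq_mul]
    have h4 : (k : ℝ) * (2 * Real.pi / k) = 2 * Real.pi := by field_simp
    rw [h4]
    have h5 : cL * ∑ j, geoDist (rot Q (x j)) (xh j) ≤ cL * D := by gcongr
    refine mul_le_mul_of_nonneg_right ?_ hr0
    linarith
  have hsplit : ∑ j, M j * b j = ∑ j, (M j - f w (x j)) * b j
      + ∑ j, (f w (x j) - f (rot Q.symm z) (rot Q.symm (xh j))) * b j
      + ∑ j, f (rot Q.symm z) (rot Q.symm (xh j)) * b j := by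
    simp only [← Finset.sum_add_distrib]
    exact Finset.sum_congr rfl fun j _ => by ring
  set B := t * √k + cL * (2 * Real.pi) + cL * D + 3 * ε * k with hB
  have hB0 : 0 ≤ B := by positivity
  have hfin : cl * k / Real.pi ^ 2 * r ^ 2 ≤ B * r := by
    have h1 := hnoise z hz
    have h2 : t * √(∑ j, b j ^ 2) ≤ t * (√k * r) := by gcongr
    have h3 : ε * ∑ j, |b j| ≤ ε * (k * r) := by gcongr
    have h4 : cl / 2 * (2 * k / Real.pi ^ 2 * r ^ 2) ≤ cl / 2 * ∑ j, b j ^ 2 := by gcongr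
    have h5 : cl / 2 * (2 * k / Real.pi ^ 2 * r ^ 2) = cl * k / Real.pi ^ 2 * r ^ 2 := by ring
    have h6 : B * r = t * (√k * r) + (cL * (2 * Real.pi) + cL * D + 2 * ε * k) * r
      + ε * (k * r) := by rw [hB]; ring
    linarith
  have hrB : r ≤ Real.pi ^ 2 / (cl * k) * B := by
    rcases hr0.eq_or_lt with h0 | h0
    · rw [← h0]
      positivity
    · have h6 : cl * k / Real.pi ^ 2 * r ≤ B := le_of_mul_le_mul_right (by linarith [hfin]) h0
      calc r = Real.pi ^ 2 / (cl * k) * (cl * k / Real.pi ^ 2 * r) := by field_simp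
        _ ≤ _ := by gcongr
  have := geoDist_triangle zh z (rot Q w)
  rw [geoDist_comm z] at this
  linarith

/-! ### Synchronization -/

/-- Resolution of the identity by an isotropic tuple: it writes every vector as a combination of the
points, so that a linear map is controlled by its values on them. -/
theorem sum_inner_mul {ι : Type*} [Fintype ι] {y : ι → Circle} (hy : ∑ i, (y i : ℂ) ^ 2 = 0)
    (v : ℂ) : ∑ i, (v * star (y i : ℂ)).re • (y i : ℂ) = ((Fintype.card ι : ℝ) / 2) • v := by
  have h1 : ∀ i, (v * star (y i : ℂ)).re • (y i : ℂ)
      = 1 / 2 * v + 1 / 2 * star v * (y i : ℂ) ^ 2 := by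
    intro i
    have : (((v * star (y i : ℂ)).re : ℝ) : ℂ) = (v * star (y i : ℂ)
        + star (v * star (y i : ℂ))) / 2 := Complex.re_eq_add_conj _
    rw [Complex.real_smul, this, star_mul, star_star]
    linear_combination (1 / 2) * v * coe_mul_star (y i)
  simp_rw [h1]
  rw [Finset.sum_add_distrib, ← Finset.mul_sum _ _ (1 / 2 * star v), hy]
  simp
  ring

/-- Two orthogonal transformations that nearly agree on a well spread sample nearly agree
everywhere. -/
theorem geoDist_rot_rot_le {ι : Type} [Fintype ι] (hk : 3 ≤ Fintype.card ι) {x xr : ι → Circle}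
    {ρ r : ℝ} (hxr : xr ∈ regularPositions ι) (hx : ∀ i, geoDist (x i) (xr i) ≤ ρ)
    (hρ : ρ ≤ 1 / 4) (P Q : Orth)
    (h : ∀ i, geoDist (rot P (x i)) (rot Q (x i)) ≤ r) (z : Circle) :
    geoDist (rot P z) (rot Q z) ≤ 2 * Real.pi * r := by
  have : Nonempty ι := Fintype.card_pos_iff.1 (by omega)
  have hr : 0 ≤ r := (geoDist_nonneg _ _).trans (h (Classical.arbitrary ι))
  have hρ0 : 0 ≤ ρ := (geoDist_nonneg _ _).trans (hx (Classical.arbitrary ι))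
  have hkpos : (0 : ℝ) < Fintype.card ι := by exact_mod_cast (by omega : 0 < Fintype.card ι)
  set L : ℂ →L[ℝ] ℂ := (P : ℂ →L[ℝ] ℂ) - (Q : ℂ →L[ℝ] ℂ) with hL
  have hLv : ∀ v, L v = P v - Q v := fun v => rfl
  have hLx : ∀ i, ‖L (xr i)‖ ≤ r + ‖L‖ * ρ := by
    intro i
    have h1 : ‖L (x i)‖ ≤ r := (norm_sub_le_geoDist (rot P (x i)) (rot Q (x i))).trans (h i)
    have h2 : ‖L ((xr i : ℂ) - x i)‖ ≤ ‖L‖ * ρ := by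
      refine (L.le_opNorm _).trans ?_
      gcongr
      rw [norm_sub_rev]
      exact (norm_sub_le_geoDist _ _).trans (hx i)
    calc ‖L (xr i)‖ = ‖L (x i) + L ((xr i : ℂ) - x i)‖ := by rw [← map_add, add_sub_cancel]
      _ ≤ _ := (norm_add_le _ _).trans (add_le_add h1 h2)
  -- Passing from `x i` to `xr i` costs `‖L‖ ρ`, so the bound on `‖L‖` involves itself; `ρ ≤ 1 / 4`
  -- lets that term be absorbed.
  have hop : ‖L‖ ≤ 2 * (r + ‖L‖ * ρ) := by
    refine L.opNorm_le_bound (by positivity) fun v => ?_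
    have h1 := sum_inner_mul (sum_sq_regularPositions hk hxr) v
    have h2 : (Fintype.card ι : ℝ) / 2 * ‖L v‖
        ≤ Fintype.card ι * (‖v‖ * (r + ‖L‖ * ρ)) := by
      calc (Fintype.card ι : ℝ) / 2 * ‖L v‖ = ‖L (((Fintype.card ι : ℝ) / 2) • v)‖ := by
            rw [map_smul, norm_smul, Real.norm_eq_abs, abs_of_pos (by positivity)]
        _ = ‖∑ i, (v * star (xr i : ℂ)).re • L (xr i)‖ := by rw [← h1, map_sum]; simp only [map_smul]
        _ ≤ ∑ i, ‖(v * star (xr i : ℂ)).re • L (xr i)‖ := norm_sum_le _ _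
        _ ≤ ∑ _i : ι, ‖v‖ * (r + ‖L‖ * ρ) := by
            refine Finset.sum_le_sum fun i _ => ?_
            rw [norm_smul]
            gcongr
            · refine (Complex.abs_re_le_norm _).trans ?_
              simp [Circle.norm_coe]
            · exact hLx i
        _ = _ := by rw [Finset.sum_const, Finset.card_univ, nsmul_eq_mul]
    have h3 : (Fintype.card ι : ℝ) * ‖L v‖
        ≤ Fintype.card ι * (2 * (r + ‖L‖ * ρ) * ‖v‖) := by linarith
    exact le_of_mul_le_mul_left h3 hkpos
  have hop' : ‖L‖ ≤ 4 * r := by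
    have : ‖L‖ * ρ ≤ ‖L‖ * (1 / 4) := by gcongr
    linarith
  have hLz : ‖(rot P z : ℂ) - rot Q z‖ ≤ 4 * r := by
    have := L.le_opNorm (z : ℂ)
    rw [Circle.norm_coe, mul_one] at this
    exact this.trans hop'
  have hp := Real.pi_pos
  calc _ ≤ _ := geoDist_le_norm_sub _ _
    _ ≤ Real.pi / 2 * (4 * r) := by gcongr
    _ = _ := by ring

/-- The synchronization step, once both refined localizations are accurate. -/
theorem orthDist_output_le {n : ℕ} {S S' : Finset (Fin n)} (hSS' : S' ⊆ Sᶜ)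
    (hcard : 3 ≤ (Sᶜ ∩ S'ᶜ).card) {x x2 x2' xhat : Fin n → Circle} {P P' Q : Orth} {r ρ : ℝ}
    (h2 : ∀ i, i ∉ S → geoDist (x2 i) (rot P (x i)) ≤ r)
    (h2' : ∀ i, i ∉ S' → geoDist (x2' i) (rot P' (x i)) ≤ r)
    (hmin : IsMinOn (fun R : Orth => dInf (fun i : ↥(Sᶜ ∩ S'ᶜ) => x2 i)
      (fun i : ↥(Sᶜ ∩ S'ᶜ) => rot R (x2' i))) univ Q)
    (hxhat : ∀ j, xhat j = if j ∈ S then rot Q (x2' j) else x2 j)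
    {xr : ↥(Sᶜ ∩ S'ᶜ) → Circle} (hxr : xr ∈ regularPositions ↥(Sᶜ ∩ S'ᶜ))
    (hx : ∀ i : ↥(Sᶜ ∩ S'ᶜ), geoDist (x i) (xr i) ≤ ρ) (hρ : ρ ≤ 1 / 4) :
    orthDist xhat x ≤ (1 + 8 * Real.pi) * r := by
  have hp := Real.pi_pos
  obtain ⟨i₀, hi₀⟩ : (Sᶜ ∩ S'ᶜ).Nonempty := Finset.card_pos.1 (by omega)
  have hS : ∀ i ∈ Sᶜ ∩ S'ᶜ, i ∉ S ∧ i ∉ S' := by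
    intro i hi
    simpa using hi
  have hr : 0 ≤ r := (geoDist_nonneg _ _).trans (h2 i₀ (hS i₀ hi₀).1)
  have hdInf : dInf (fun i : ↥(Sᶜ ∩ S'ᶜ) => x2 i) (fun i : ↥(Sᶜ ∩ S'ᶜ) => rot Q (x2' i))
      ≤ 2 * r := by
    -- The competitor undoes `P'` and applies `P`, which aligns both refined tuples with `P x`.
    refine (isMinOn_iff.1 hmin (P'.symm.trans P) (mem_univ _)).trans ?_
    refine dInf_le (by positivity) fun i => ?_
    refine (geoDist_triangle _ (rot P (x i)) _).trans ?_
    have h3 := h2 i (hS i i.2).1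
    have h4 := h2' i (hS i i.2).2
    rw [rot_trans, geoDist_rot, geoDist_comm (x i), 
      ← geoDist_rot P' (rot P'.symm (x2' i)), rot_rot_symm]
    linarith
  -- Here `4 r` adds one refinement error on each side and the synchronization error `2 r`.
  have hPQ : ∀ z, geoDist (rot P z) (rot (P'.trans Q) z) ≤ 2 * Real.pi * (4 * r) := by
    refine geoDist_rot_rot_le (by rwa [Fintype.card_coe]) hxr (x := fun i : ↥(Sᶜ ∩ S'ᶜ) => x i)
      hx hρ _ _
      fun i => ?_
    have h3 := h2 i (hS i i.2).1
    have h4 := h2' i (hS i i.2).2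
    have h5 := (geoDist_le_dInf (fun i : ↥(Sᶜ ∩ S'ᶜ) => x2 i)
      (fun i : ↥(Sᶜ ∩ S'ᶜ) => rot Q (x2' i)) i).trans hdInf
    rw [rot_trans]
    have h6 := geoDist_triangle (rot P (x i)) (x2 i) (rot Q (rot P' (x i)))
    have h7 := geoDist_triangle (x2 i) (rot Q (x2' i)) (rot Q (rot P' (x i)))
    rw [geoDist_rot] at h7
    rw [geoDist_comm] at h3
    linarith
  refine orthDist_le (by positivity) P fun j => ?_
  rw [hxhat j]
  split_ifs with hj
  · have hj' : j ∉ S' := fun h => Finset.mem_compl.1 (hSS' h) hj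
    have h3 := geoDist_triangle (rot Q (x2' j)) (rot Q (rot P' (x j))) (rot P (x j))
    rw [geoDist_rot, ← rot_trans, geoDist_comm (rot (P'.trans Q) (x j))] at h3
    have h4 := hPQ (x j)
    have h5 := h2' j hj'
    linarith
  · have h3 := h2 j hj
    have : 0 ≤ 8 * Real.pi * r := by positivity
    linarith

/-! ### Spread of the latent positions -/

/-- The argument of a point of the circle, in `[0, 2π)`. -/
def circleArg (z : Circle) : ℝ :=
  if Complex.arg z < 0 then Complex.arg z + 2 * Real.pi else Complex.arg z

theorem circleArg_nonneg (z : Circle) : 0 ≤ circleArg z := by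
  rw [circleArg]
  have := Complex.neg_pi_lt_arg z
  have := Real.pi_pos
  split_ifs <;> linarith

theorem circleArg_lt (z : Circle) : circleArg z < 2 * Real.pi := by
  rw [circleArg]
  have := Complex.arg_le_pi z
  have := Real.pi_pos
  split_ifs <;> linarith

theorem exp_circleArg (z : Circle) : Circle.exp (circleArg z) = z := by
  rw [circleArg]
  split_ifs
  · rw [Circle.exp_add, Circle.exp_two_pi, mul_one, Circle.exp_arg]
  · exact Circle.exp_arg z

theorem circleArg_exp {t : ℝ} (ht : t ∈ Ico 0 (2 * Real.pi)) : circleArg (Circle.exp t) = t := by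
  obtain ⟨m, hm⟩ := Circle.exp_eq_exp.1 (exp_circleArg (Circle.exp t))
  have h1 := circleArg_nonneg (Circle.exp t)
  have h2 := circleArg_lt (Circle.exp t)
  have hp := Real.two_pi_pos
  have h3 : (-1 : ℝ) < m := by
    by_contra! h
    nlinarith [ht.1, ht.2]
  have h4 : (m : ℝ) < 1 := by
    by_contra! h
    nlinarith [ht.1, ht.2]
  have h5 : m = 0 := by
    have : (-1 : ℤ) < m := by exact_mod_cast h3
    have : m < (1 : ℤ) := by exact_mod_cast h4
    omega
  rw [hm, h5]
  simp

theorem measurable_circleArg : Measurable circleArg := by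
  have h : Measurable fun z : Circle => Complex.arg z :=
    Complex.measurable_arg.comp (by fun_prop : Continuous fun z : Circle => (z : ℂ)).measurable
  exact Measurable.ite (measurableSet_lt h measurable_const) (h.add_const _) h

theorem uniformCircle_circleArg_lt {c : ℝ} (h0 : 0 ≤ c) (h1 : c ≤ 1) :
    uniformCircle.real {z | circleArg z < 2 * Real.pi * c} = c := by
  have hp := Real.two_pi_pos
  have hm : MeasurableSet {z | circleArg z < 2 * Real.pi * c} :=
    measurableSet_lt measurable_circleArg measurable_const
  rw [uniformCircle, map_measureReal_apply Circle.exp.continuous.measurable hm,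
    measureReal_def,
    cond_apply measurableSet_Ico, ENNReal.toReal_mul, ENNReal.toReal_inv, ← measureReal_def,
    ← measureReal_def]
  have h : Ico 0 (2 * Real.pi) ∩ Circle.exp ⁻¹' {z | circleArg z < 2 * Real.pi * c}
      = Ico 0 (2 * Real.pi * c) := by
    ext t
    simp only [mem_inter_iff, mem_preimage, mem_ofPred_eq]
    constructor
    · rintro ⟨ht, ht'⟩
      rw [circleArg_exp ht] at ht'
      exact ⟨ht.1, ht'⟩
    · rintro ⟨ht, ht'⟩
      have : t ∈ Ico 0 (2 * Real.pi) := ⟨ht, by nlinarith⟩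
      exact ⟨this, by rwa [circleArg_exp this]⟩
  rw [h, Real.volume_real_Ico_of_le hp.le, Real.volume_real_Ico_of_le (by positivity)]
  field_simp
  ring

/-- A bijection with `Fin k` that sorts a family of real numbers. -/
theorem exists_equiv_fin_monotone {ι : Type*} [Fintype ι] (θ : ι → ℝ) :
    ∃ σ : ι ≃ Fin (Fintype.card ι), ∀ i j, σ i ≤ σ j → θ i ≤ θ j := by
  set e := Fintype.equivFin ι
  refine ⟨e.trans (Tuple.sort (θ ∘ e.symm)).symm, fun i j hij => ?_⟩
  have := Tuple.monotone_sort (θ ∘ e.symm) hij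
  simpa using this

/-- The numbers of points in the arcs `[0, 2π j / k)` deviate by at most `s` from uniformity. -/
def IsSpread {ι : Type*} [Fintype ι] (s : ℝ) (x : ι → Circle) : Prop :=
  ∀ j ∈ Finset.range (Fintype.card ι + 1),
    |((Finset.univ.filter fun i => circleArg (x i) < 2 * Real.pi * (j / Fintype.card ι)).card : ℝ)
      - j| ≤ s

/-- Match the sorted points with the grid in order. The rank of a point is squeezed between the
counts of the two arcs ending at the grid angles around it, hence is within `s + 1` of its rescaled
angle. -/
theorem IsSpread.exists_regularPositions {ι : Type} [Fintype ι] {s : ℝ} {x : ι → Circle}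
    (h : IsSpread s x) : ∃ xr ∈ regularPositions ι,
      ∀ i, geoDist (x i) (xr i) ≤ 2 * Real.pi * ((s + 1) / Fintype.card ι) := by
  classical
  unfold IsSpread at h
  have hp := Real.two_pi_pos
  set k := Fintype.card ι with hk
  obtain ⟨σ, hσ⟩ : ∃ σ : ι ≃ Fin k, ∀ i j, σ i ≤ σ j → circleArg (x i) ≤ circleArg (x j) :=
    exists_equiv_fin_monotone fun i => circleArg (x i)
  refine ⟨fun i => Circle.exp (2 * Real.pi * (σ i : ℝ) / Fintype.card ι),
    ⟨σ, fun i => rfl⟩, fun i => ?_⟩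
  have hkpos : (0 : ℝ) < k := by
    have : Nonempty ι := ⟨i⟩
    exact_mod_cast Fintype.card_pos
  set θ := circleArg (x i) with hθ
  have hθ0 : 0 ≤ θ := circleArg_nonneg _
  have hθ1 : θ < 2 * Real.pi := circleArg_lt _
  set u := k * θ / (2 * Real.pi) with hu
  have hu0 : 0 ≤ u := by positivity
  have huk : u < k := by
    rw [hu, div_lt_iff₀ hp]
    gcongr
  set b := ⌊u⌋₊ with hb
  have hb1 : (b : ℝ) ≤ u := Nat.floor_le hu0
  have hb2 : u < b + 1 := Nat.lt_floor_add_one u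
  have hbk : b < k := by exact_mod_cast hb1.trans_lt huk
  have hθu : θ = 2 * Real.pi * (u / k) := by rw [hu]; field_simp
  have hN1 : ((Finset.univ.filter fun l => circleArg (x l) < 2 * Real.pi * (b / k)).card : ℝ)
      ≤ (σ i : ℕ) := by
    have : (Finset.univ.filter fun l => circleArg (x l) < 2 * Real.pi * (b / k)).card
        ≤ (Finset.Iio (σ i)).card := by
      refine Finset.card_le_card_of_injOn σ ?_ σ.injective.injOn
      intro l hl
      simp only [Finset.coe_filter, Finset.mem_univ, true_and, mem_ofPred_eq] at hl
      simp only [Finset.coe_Iio, mem_Iio]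
      by_contra! hcon
      have h1 := hσ _ _ hcon
      have h2 : 2 * Real.pi * (b / k) ≤ θ := by rw [hθu]; gcongr
      linarith
    rw [Fin.card_Iio] at this
    exact_mod_cast this
  -- Ranks start at `0`, so the points of rank at most `σ i` number `σ i + 1`.
  have hN2 : ((σ i : ℕ) : ℝ) + 1
      ≤ (Finset.univ.filter fun l => circleArg (x l) < 2 * Real.pi * ((b + 1 : ℕ) / k)).card := by
    have : (Finset.Iic (σ i)).card
        ≤ (Finset.univ.filter fun l => circleArg (x l) < 2 * Real.pi * ((b + 1 : ℕ) / k)).card := by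
      refine Finset.card_le_card_of_injOn σ.symm ?_ σ.symm.injective.injOn
      intro l hl
      simp only [Finset.coe_Iic, mem_Iic] at hl
      simp only [Finset.coe_filter, Finset.mem_univ, true_and, mem_ofPred_eq]
      have h1 := hσ (σ.symm l) i (by simpa using hl)
      refine h1.trans_lt ?_
      rw [← hθ, hθu]
      push_cast
      gcongr
    rw [Fin.card_Iic] at this
    exact_mod_cast this
  have h1 := abs_le.1 (h b (Finset.mem_range.2 (by omega)))
  have h2 := abs_le.1 (h (b + 1) (Finset.mem_range.2 (by omega)))
  have h3 : |u - (σ i : ℕ)| ≤ s + 1 := by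
    push_cast at h2 hN2
    rw [abs_le]
    constructor <;> linarith [h1.1, h2.2]
  change geoDist (x i) (Circle.exp (2 * Real.pi * (σ i : ℕ) / k)) ≤ _
  rw [← exp_circleArg (x i), ← hθ]
  refine (geoDist_exp_le _ _).trans ?_
  have h4 : θ - 2 * Real.pi * (σ i : ℕ) / k = 2 * Real.pi * ((u - (σ i : ℕ)) / k) := by
    rw [hθu]; ring
  rw [h4, abs_mul, abs_of_pos hp, abs_div, abs_of_pos hkpos]
  gcongr

theorem measurableSet_isSpread {ι : Type*} [Fintype ι] (s : ℝ) :
    MeasurableSet {x : ι → Circle | IsSpread s x} := by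
  classical
  have : {x : ι → Circle | IsSpread s x} = ⋂ j ∈ Finset.range (Fintype.card ι + 1),
      {x | |∑ i, (if circleArg (x i) < 2 * Real.pi * (j / Fintype.card ι) then (1 : ℝ) else 0)
        - j| ≤ s} := by
    ext x
    simp [IsSpread]
  rw [this]
  refine Finset.measurableSet_biInter _ fun j _ => measurableSet_le ?_ measurable_const
  refine Measurable.abs (Measurable.sub_const (Finset.measurable_sum _ fun i _ => ?_) _)
  exact Measurable.ite (measurableSet_lt (measurable_circleArg.comp (measurable_pi_apply i))
    measurable_const) measurable_const measurable_const

/-- Hoeffding's inequality for counts of independent events with the same probability. -/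
theorem measureReal_lt_abs_sum_indicator_le {Ω ι : Type*} [MeasurableSpace Ω] {μ : Measure Ω}
    [IsProbabilityMeasure μ] [Fintype ι] {x : ι → Ω → Circle} (hx : ∀ i, Measurable (x i))
    (hind : iIndepFun x μ) {V : Set Circle} (hV : MeasurableSet V) {p s : ℝ}
    (hp : ∀ i, (μ.map (x i)).real V = p) (hs : 0 ≤ s) :
    μ.real {ω | s < |∑ i, V.indicator (fun _ => (1 : ℝ)) (x i ω) - Fintype.card ι * p|}
      ≤ 2 * Real.exp (-(2 * s ^ 2 / Fintype.card ι)) := by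
  set X : ι → Ω → ℝ := fun i ω => V.indicator (fun _ => (1 : ℝ)) (x i ω) - p with hX
  have hm : Measurable (V.indicator fun _ : Circle => (1 : ℝ)) := measurable_const.indicator hV
  have hint : ∀ i, ∫ ω, V.indicator (fun _ => (1 : ℝ)) (x i ω) ∂μ = p := by
    intro i
    rw [← hp i, ← integral_map (hx i).aemeasurable hm.aestronglyMeasurable]
    rw [integral_indicator hV]
    simp
  have hsub : ∀ i, HasSubgaussianMGF (X i) ((‖(1 : ℝ) - 0‖₊ / 2) ^ 2) μ := by
    intro i
    have := hasSubgaussianMGF_of_mem_Icc (μ := μ) (a := 0) (b := 1)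
      (X := fun ω => V.indicator (fun _ => (1 : ℝ)) (x i ω)) (hm.comp (hx i)).aemeasurable
      (Filter.Eventually.of_forall fun ω => by
        by_cases h : x i ω ∈ V <;> simp [h])
    rw [hint i] at this
    exact this
  have hindX : iIndepFun X μ :=
    hind.comp (fun _ z => V.indicator (fun _ => (1 : ℝ)) z - p) fun _ => hm.sub_const p
  have hindX' : iIndepFun (fun i => -X i) μ :=
    hindX.comp (fun _ z => -z) fun _ => measurable_neg
  have h1 := HasSubgaussianMGF.measure_sum_ge_le_of_iIndepFun hindX (s := Finset.univ)
    (fun i _ => hsub i) hs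
  have h2 := HasSubgaussianMGF.measure_sum_ge_le_of_iIndepFun hindX' (s := Finset.univ)
    (fun i _ => (hsub i).neg) hs
  have hexp : Real.exp (-s ^ 2 / (2 * ((∑ _i : ι, (‖(1 : ℝ) - 0‖₊ / 2) ^ 2 : NNReal) : ℝ)))
      = Real.exp (-(2 * s ^ 2 / Fintype.card ι)) := by
    congr 1
    simp
    ring
  rw [hexp] at h1 h2
  have hsum : ∀ ω, ∑ i, V.indicator (fun _ => (1 : ℝ)) (x i ω) - Fintype.card ι * p
      = ∑ i, X i ω := by
    intro ω
    simp [hX, Finset.sum_sub_distrib]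
  have hsubset : {ω | s < |∑ i, V.indicator (fun _ => (1 : ℝ)) (x i ω) - Fintype.card ι * p|}
      ⊆ {ω | s ≤ ∑ i, X i ω} ∪ {ω | s ≤ ∑ i, (-X i) ω} := by
    intro ω hω
    rw [mem_ofPred_eq, hsum, lt_abs] at hω
    rcases hω with hω | hω
    · exact Or.inl hω.le
    · right
      simp only [mem_ofPred_eq, Pi.neg_apply, Finset.sum_neg_distrib]
      exact hω.le
  calc _ ≤ _ := measureReal_mono hsubset
    _ ≤ _ := measureReal_union_le _ _
    _ ≤ _ := by linarith

/-- Union bound over the `k + 1` arcs, each handled by Hoeffding's inequality. -/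
theorem measureReal_not_isSpread_le {Ω ι : Type*} [MeasurableSpace Ω] {μ : Measure Ω}
    [IsProbabilityMeasure μ] [Fintype ι] [Nonempty ι] {x : ι → Ω → Circle}
    (hx : ∀ i, Measurable (x i)) (hind : iIndepFun x μ) (hlaw : ∀ i, μ.map (x i) = uniformCircle)
    {s : ℝ} (hs : 0 ≤ s) :
    μ.real {ω | ¬ IsSpread s fun i => x i ω}
      ≤ (Fintype.card ι + 1) * (2 * Real.exp (-(2 * s ^ 2 / Fintype.card ι))) := by
  classical
  have hkpos : (0 : ℝ) < Fintype.card ι := by exact_mod_cast Fintype.card_pos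
  have hsubset : {ω | ¬ IsSpread s fun i => x i ω} ⊆ ⋃ j ∈ Finset.range (Fintype.card ι + 1),
      {ω | s < |∑ i, ({z | circleArg z < 2 * Real.pi * (j / Fintype.card ι)} : Set Circle).indicator
        (fun _ => (1 : ℝ)) (x i ω) - Fintype.card ι * (j / Fintype.card ι)|} := by
    intro ω hω
    simp only [mem_ofPred_eq, IsSpread, not_forall, not_le] at hω
    obtain ⟨j, hj, hj'⟩ := hω
    refine mem_biUnion hj ?_
    rw [mem_ofPred_eq, mul_div_cancel₀ _ hkpos.ne']
    simpa only [Finset.natCast_card_filter, indicator_apply, mem_ofPred_eq] using hj'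
  refine (measureReal_mono hsubset (measure_ne_top _ _)).trans ((measureReal_biUnion_finset_le _ _).trans ?_)
  refine (Finset.sum_le_sum fun (j : ℕ) hj => measureReal_lt_abs_sum_indicator_le
    (V := {z | circleArg z < 2 * Real.pi * (j / Fintype.card ι)}) hx hind
    (measurableSet_lt measurable_circleArg measurable_const)
    (p := (j / Fintype.card ι : ℝ)) (fun i => ?_) hs).trans ?_
  · rw [hlaw]
    refine uniformCircle_circleArg_lt (by positivity) ?_
    rw [div_le_one hkpos]
    exact_mod_cast Nat.lt_succ_iff.1 (Finset.mem_range.1 hj)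
  · rw [Finset.sum_const, Finset.card_range, nsmul_eq_mul]
    push_cast
    exact le_rfl

/-! ### Linear forms of the noise -/

/-- The index set of the entries above the diagonal. -/
abbrev UpperPairs (n : ℕ) : Type := {p : Fin n × Fin n // p.1 < p.2}

/-- The linear form with weights `B`, evaluated at the entries of `W` above the diagonal, exceeds
`t` times the Euclidean norm of its weights. -/
def Exceeds {n : ℕ} (t : ℝ) (B W : Fin n → Fin n → ℝ) : Prop :=
  t * √(∑ p : UpperPairs n, B p.1.1 p.1.2 ^ 2) < ∑ p : UpperPairs n, B p.1.1 p.1.2 * W p.1.1 p.1.2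

/-- Only the entries above the diagonal matter. This permits replacing `f (x i) (x j)` by the
conditional mean, since the model identifies the two for `i < j` only. -/
theorem exceeds_congr {n : ℕ} {t : ℝ} {B W W' : Fin n → Fin n → ℝ}
    (h : ∀ i j, i < j → W i j = W' i j) : Exceeds t B W ↔ Exceeds t B W' := by
  have : ∀ p : UpperPairs n, W p.1.1 p.1.2 = W' p.1.1 p.1.2 := fun p => h _ _ p.2
  simp only [Exceeds, this]

theorem measurableSet_exceeds {n : ℕ} {α : Type*} [MeasurableSpace α] (t : ℝ)
    {B W : α → Fin n → Fin n → ℝ} (hB : ∀ i j, Measurable fun q => B q i j)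
    (hW : ∀ i j, i < j → Measurable fun q => W q i j) :
    MeasurableSet {q | Exceeds t (B q) (W q)} := by
  refine measurableSet_lt ?_ ?_
  · exact (Real.continuous_sqrt.measurable.comp
      (Finset.measurable_sum _ fun p _ => (hB _ _).pow_const 2)).const_mul t
  · exact Finset.measurable_sum _ fun p _ => (hB _ _).mul (hW _ _ p.2)

theorem sum_sum_eq_two_mul_sum_upperPairs {n : ℕ} {H : Fin n → Fin n → ℝ}
    (hs : ∀ i j, H i j = H j i) (h0 : ∀ i, H i i = 0) :
    ∑ i, ∑ j, H i j = 2 * ∑ p : UpperPairs n, H p.1.1 p.1.2 := by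
  have h1 : ∑ p : UpperPairs n, H p.1.1 p.1.2 = ∑ i, ∑ j, if i < j then H i j else 0 := by
    rw [← Fintype.sum_prod_type' (f := fun i j => if i < j then H i j else 0),
      ← Finset.sum_filter]
    exact (Finset.sum_subtype _ (p := fun p : Fin n × Fin n => p.1 < p.2) (by simp)
      fun p : Fin n × Fin n => H p.1 p.2).symm
  have h2 : ∑ i, ∑ j, (if i < j then H i j else 0) = ∑ i, ∑ j, if j < i then H i j else 0 := by
    rw [Finset.sum_comm]
    refine Finset.sum_congr rfl fun i _ => Finset.sum_congr rfl fun j _ => ?_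
    rw [hs]
  rw [two_mul, h1]
  conv_rhs => rw [h2]
  nth_rewrite 2 [← h2]
  simp only [← Finset.sum_add_distrib]
  refine Finset.sum_congr rfl fun i _ => Finset.sum_congr rfl fun j _ => ?_
  rcases lt_trichotomy i j with h | h | h
  · simp [h, h.not_gt]
  · simp [h, h0]
  · simp [h, h.not_gt]

/-- Extension by `1` of a tuple indexed by a finite set. -/
def extendOne {n : ℕ} {S : Finset (Fin n)} (y : ↥S → Circle) (a : Fin n) : Circle :=
  if h : a ∈ S then y ⟨a, h⟩ else 1

theorem extendOne_coe {n : ℕ} {S : Finset (Fin n)} (y : ↥S → Circle) (a : ↥S) :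
    extendOne y a = y a := by simp [extendOne]

theorem measurable_extendOne {n : ℕ} {S : Finset (Fin n)} (a : Fin n) :
    Measurable fun y : ↥S → Circle => extendOne y a := by
  unfold extendOne
  by_cases h : a ∈ S
  · simpa [h] using measurable_pi_apply (⟨a, h⟩ : ↥S)
  · simp [h]

/-- Weights comparing the pairwise distances of two tuples. -/
def pairWeights {n : ℕ} {S : Finset (Fin n)} (y y' : ↥S → Circle) (a b : Fin n) : ℝ :=
  if a ∈ S ∧ b ∈ S then
    geoDist (extendOne y' a) (extendOne y' b) - geoDist (extendOne y a) (extendOne y b)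
  else 0

/-- The differences of the distances from `z'` and from `z` to the points of a tuple. -/
def diffWeights {n : ℕ} {S : Finset (Fin n)} (y : ↥S → Circle) (z z' : Circle) (b : Fin n) : ℝ :=
  if b ∈ S then geoDist z' (extendOne y b) - geoDist z (extendOne y b) else 0

/-- Weights comparing, on row `i`, the distances from `z` and `z'` to the points of a tuple. -/
def rowWeights {n : ℕ} {S : Finset (Fin n)} (i : Fin n) (z z' : Circle) (y : ↥S → Circle)
    (a b : Fin n) : ℝ :=
  (if a = i then diffWeights y z z' b else 0) + if b = i then diffWeights y z z' a else 0

theorem measurable_rowWeights {n : ℕ} {S : Finset (Fin n)} (i : Fin n) (z z' : Circle)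
    (a b : Fin n) : Measurable fun y : ↥S → Circle => rowWeights i z z' y a b := by
  have hg : ∀ w : Circle, Measurable fun v => geoDist w v := fun w =>
    (continuous_geoDist.comp (by fun_prop : Continuous fun v : Circle => (w, v))).measurable
  have hd : ∀ c, Measurable fun y : ↥S → Circle => diffWeights y z z' c := by
    intro c
    unfold diffWeights
    by_cases h : c ∈ S
    · simp only [h, if_true]
      exact ((hg z').comp (measurable_extendOne c)).sub ((hg z).comp (measurable_extendOne c))
    · simp [h]
  unfold rowWeights
  refine Measurable.add ?_ ?_
  · by_cases h : a = i
    · simpa [h] using hd b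
    · simp [h]
  · by_cases h : b = i
    · simpa [h] using hd a
    · simp [h]

/-- The noise is large in a direction relevant to the initial localization on `S`. -/
def LargeNoiseInit {n : ℕ} (S : Finset (Fin n)) (t : ℝ) (W : Fin n → Fin n → ℝ) : Prop :=
  ∃ q ∈ regularPositions ↥S ×ˢ regularPositions ↥S, Exceeds t (pairWeights q.1 q.2) W

/-- The noise is large in a direction relevant to the refinement based on the localization `y` of
the points of `S`. -/
def LargeNoiseRefine {n : ℕ} (k : ℕ) {S : Finset (Fin n)} (t : ℝ) (y : ↥S → Circle)
    (W : Fin n → Fin n → ℝ) : Prop :=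
  ∃ q ∈ (Set.univ : Set (Fin n)) ×ˢ grid k ×ˢ grid k,
    q.1 ∉ S ∧ Exceeds t (rowWeights q.1 q.2.1 q.2.2 y) W

theorem sum_coe_finset_eq {n : ℕ} (S : Finset (Fin n)) (g : Fin n → ℝ) :
    ∑ i : ↥S, g i = ∑ a, if a ∈ S then g a else 0 := by
  rw [Finset.sum_coe_sort S g, Finset.sum_ite_mem, Finset.univ_inter]

theorem sum_sum_coe_finset_eq {n : ℕ} (S : Finset (Fin n)) (g : Fin n → Fin n → ℝ) :
    ∑ i : ↥S, ∑ j : ↥S, g i j = ∑ a, ∑ b, if a ∈ S ∧ b ∈ S then g a b else 0 := by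
  rw [sum_coe_finset_eq S fun a => ∑ j : ↥S, g a j]
  refine Finset.sum_congr rfl fun a _ => ?_
  by_cases h : a ∈ S
  · simp only [h, if_true, true_and]
    exact sum_coe_finset_eq S (g a)
  · simp [h]

theorem neg_le_sum_of_not_largeNoiseInit {n : ℕ} {S : Finset (Fin n)} {t : ℝ} (ht : 0 ≤ t)
    {W : Fin n → Fin n → ℝ} (hW : ∀ i j, W i j = W j i) (h : ¬ LargeNoiseInit S t W)
    {y y' : ↥S → Circle} (hy : y ∈ regularPositions ↥S) (hy' : y' ∈ regularPositions ↥S) :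
    -(2 * t * √(∑ i : ↥S, ∑ j : ↥S, (geoDist (y i) (y j) - geoDist (y' i) (y' j)) ^ 2))
      ≤ ∑ i : ↥S, ∑ j : ↥S, W i j * (geoDist (y i) (y j) - geoDist (y' i) (y' j)) := by
  have h1 : ¬ Exceeds t (pairWeights y y') W := fun h' => h ⟨(y, y'), ⟨hy, hy'⟩, h'⟩
  rw [Exceeds, not_lt] at h1
  have hB : ∀ a b, pairWeights y y' a b = pairWeights y y' b a := by
    intro a b
    simp only [pairWeights, and_comm, geoDist_comm (extendOne _ a)]
  have hB0 : ∀ a, pairWeights y y' a a = 0 := by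
    intro a
    simp [pairWeights, geoDist_self]
  have h2 := sum_sum_eq_two_mul_sum_upperPairs (H := fun a b => pairWeights y y' a b ^ 2)
    (fun a b => by rw [hB]) (fun a => by rw [hB0]; simp)
  have h3 := sum_sum_eq_two_mul_sum_upperPairs (H := fun a b => pairWeights y y' a b * W a b)
    (fun a b => by rw [hB, hW]) (fun a => by rw [hB0]; simp)
  have h4 : ∑ i, ∑ j, (geoDist (y i) (y j) - geoDist (y' i) (y' j)) ^ 2
      = ∑ a, ∑ b, pairWeights y y' a b ^ 2 := by
    have := sum_sum_coe_finset_eq S fun a b => (geoDist (extendOne y a) (extendOne y b)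
      - geoDist (extendOne y' a) (extendOne y' b)) ^ 2
    simp only [extendOne_coe] at this
    rw [this]
    refine Finset.sum_congr rfl fun a _ => Finset.sum_congr rfl fun b _ => ?_
    rw [pairWeights]
    split_ifs
    · ring
    · simp
  have h5 : ∑ i : ↥S, ∑ j : ↥S, W i j * (geoDist (y i) (y j) - geoDist (y' i) (y' j))
      = -∑ a, ∑ b, pairWeights y y' a b * W a b := by
    have := sum_sum_coe_finset_eq S fun a b => W a b * (geoDist (extendOne y a) (extendOne y b)
      - geoDist (extendOne y' a) (extendOne y' b))
    simp only [extendOne_coe] at this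
    rw [this]
    simp only [← Finset.sum_neg_distrib]
    refine Finset.sum_congr rfl fun a _ => Finset.sum_congr rfl fun b _ => ?_
    rw [pairWeights]
    split_ifs
    · ring
    · simp
  rw [h4, h5, h2, h3]
  -- The full sum of squares is twice the sum over upper pairs; the factor `√2` is given away.
  have h6 : √(∑ p : UpperPairs n, pairWeights y y' p.1.1 p.1.2 ^ 2)
      ≤ √(2 * ∑ p : UpperPairs n, pairWeights y y' p.1.1 p.1.2 ^ 2) := by
    apply Real.sqrt_le_sqrt
    have : 0 ≤ ∑ p : UpperPairs n, pairWeights y y' p.1.1 p.1.2 ^ 2 :=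
      Finset.sum_nonneg fun p _ => sq_nonneg _
    linarith
  have h7 := mul_le_mul_of_nonneg_left h6 ht
  linarith

theorem neg_le_sum_of_not_largeNoiseRefine {n k : ℕ} {S : Finset (Fin n)} {t : ℝ}
    {W : Fin n → Fin n → ℝ} (hW : ∀ i j, W i j = W j i) {y : ↥S → Circle}
    (h : ¬ LargeNoiseRefine k t y W) {i : Fin n} (hi : i ∉ S) {z z' : Circle} (hz : z ∈ grid k)
    (hz' : z' ∈ grid k) :
    -(t * √(∑ j, (geoDist z (y j) - geoDist z' (y j)) ^ 2))
      ≤ ∑ j : ↥S, W i j * (geoDist z (y j) - geoDist z' (y j)) := by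
  have h1 : ¬ Exceeds t (rowWeights i z z' y) W := fun h' =>
    h ⟨(i, z, z'), ⟨mem_univ _, hz, hz'⟩, hi, h'⟩
  rw [Exceeds, not_lt] at h1
  -- As `i ∉ S`, the row weights vanish on the diagonal and their two parts never overlap.
  have hd : diffWeights y z z' i = 0 := by simp [diffWeights, hi]
  have hB : ∀ a b, rowWeights i z z' y a b = rowWeights i z z' y b a := by
    intro a b
    simp only [rowWeights, add_comm]
  have hB0 : ∀ a, rowWeights i z z' y a a = 0 := by
    intro a
    rw [rowWeights]
    split_ifs with ha
    · rw [ha, hd, add_zero]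
    · simp
  have h2 := sum_sum_eq_two_mul_sum_upperPairs (H := fun a b => rowWeights i z z' y a b ^ 2)
    (fun a b => by rw [hB]) (fun a => by rw [hB0]; simp)
  have h3 := sum_sum_eq_two_mul_sum_upperPairs (H := fun a b => rowWeights i z z' y a b * W a b)
    (fun a b => by rw [hB, hW]) (fun a => by rw [hB0]; simp)
  have h4 : ∑ a, ∑ b, rowWeights i z z' y a b ^ 2 = 2 * ∑ b, diffWeights y z z' b ^ 2 := by
    have : ∀ a b, rowWeights i z z' y a b ^ 2 = (if a = i then diffWeights y z z' b ^ 2 else 0)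
        + if b = i then diffWeights y z z' a ^ 2 else 0 := by
      intro a b
      rw [rowWeights]
      by_cases ha : a = i <;> by_cases hb : b = i <;> simp [ha, hb, hd]
    simp only [this, Finset.sum_add_distrib]
    rw [Finset.sum_comm]
    simp [two_mul]
  have h5 : ∑ a, ∑ b, rowWeights i z z' y a b * W a b
      = 2 * ∑ b, diffWeights y z z' b * W i b := by
    have : ∀ a b, rowWeights i z z' y a b * W a b
        = (if a = i then diffWeights y z z' b * W i b else 0)
        + if b = i then diffWeights y z z' a * W i a else 0 := by
      intro a b
      rw [rowWeights, add_mul]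
      congr 1
      · split_ifs with ha
        · rw [ha]
        · simp
      · split_ifs with hb
        · rw [hb, hW a]
        · simp
    simp only [this, Finset.sum_add_distrib]
    rw [Finset.sum_comm]
    simp [two_mul]
  have h6 : ∑ j, (geoDist z (y j) - geoDist z' (y j)) ^ 2 = ∑ b, diffWeights y z z' b ^ 2 := by
    have := sum_coe_finset_eq S fun b =>
      (geoDist z (extendOne y b) - geoDist z' (extendOne y b)) ^ 2
    simp only [extendOne_coe] at this
    rw [this]
    refine Finset.sum_congr rfl fun b _ => ?_
    rw [diffWeights]
    split_ifs
    · ring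
    · simp
  have h7 : ∑ j : ↥S, W i j * (geoDist z (y j) - geoDist z' (y j))
      = -∑ b, diffWeights y z z' b * W i b := by
    have := sum_coe_finset_eq S fun b =>
      W i b * (geoDist z (extendOne y b) - geoDist z' (extendOne y b))
    simp only [extendOne_coe] at this
    rw [this, ← Finset.sum_neg_distrib]
    refine Finset.sum_congr rfl fun b _ => ?_
    rw [diffWeights]
    split_ifs
    · ring
    · simp
  rw [h6, h7]
  rw [h4] at h2
  rw [h5] at h3
  have h8 := mul_left_cancel₀ two_ne_zero h2
  have h9 := mul_left_cancel₀ two_ne_zero h3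
  rw [h8, h9]
  linarith

/-! ### Probability of large noise, for fixed latent positions -/

/-- Union bound over ordered pairs of regular tuples. The initial estimator depends on the noise, so
every possible output has to be covered. -/
theorem measureReal_largeNoiseInit_le {n : ℕ} {f : Circle → Circle → ℝ} {x : Fin n → Circle}
    {P : Measure (Fin n → Fin n → ℝ)} [IsProbabilityMeasure P] (hP : IsModelLaw f x P)
    (S : Finset (Fin n)) {t : ℝ} (ht : 0 ≤ t) :
    P.real {M | LargeNoiseInit S t fun i j => M i j - f (x i) (x j)}
      ≤ ((S.card : ℝ) ^ S.card) ^ 2 * Real.exp (-t ^ 2 / 2) := by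
  classical
  have hfin : (regularPositions ↥S ×ˢ regularPositions ↥S).Finite :=
    (finite_regularPositions _).prod (finite_regularPositions _)
  have hsubset : {M : Fin n → Fin n → ℝ | LargeNoiseInit S t fun i j => M i j - f (x i) (x j)}
      ⊆ ⋃ q ∈ hfin.toFinset,
        {M | Exceeds t (pairWeights q.1 q.2) fun i j => M i j - f (x i) (x j)} := by
    rintro M ⟨q, hq, h⟩
    exact mem_biUnion (by simpa using hq) h
  refine (measureReal_mono hsubset (measure_ne_top _ _)).trans
    ((measureReal_biUnion_finset_le _ _).trans ?_)
  refine (Finset.sum_le_sum fun q _ => hP.subGaussian (pairWeights q.1 q.2) t ht).trans ?_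
  rw [Finset.sum_const, nsmul_eq_mul]
  gcongr
  rw [← ncard_eq_toFinset_card _ hfin, ncard_prod, Nat.cast_mul, sq]
  have h := ncard_regularPositions_le ↥S
  rw [Fintype.card_coe] at h
  have h' : ((regularPositions ↥S).ncard : ℝ) ≤ (S.card : ℝ) ^ S.card := by exact_mod_cast h
  gcongr

/-- A row of the noise matrix is independent of the initial localization. -/
theorem measureReal_exceeds_rowWeights_le {n : ℕ} {f : Circle → Circle → ℝ} {x : Fin n → Circle}
    {P : Measure (Fin n → Fin n → ℝ)} [IsProbabilityMeasure P] (hP : IsModelLaw f x P)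
    {S : Finset (Fin n)} {g : (↥S → ↥S → ℝ) → ↥S → Circle} (hg : Measurable g)
    (hgmem : ∀ M, g M ∈ regularPositions ↥S) {i : Fin n} (hi : i ∉ S) (z z' : Circle) {t : ℝ}
    (ht : 0 ≤ t) :
    P.real {M | Exceeds t (rowWeights i z z' (g fun a b => M a b))
      fun i j => M i j - f (x i) (x j)} ≤ Real.exp (-t ^ 2 / 2) := by
  classical
  set E : UpperPairs n → (Fin n → Fin n → ℝ) → ℝ :=
    fun p A => A p.1.1 p.1.2 - f (x p.1.1) (x p.1.2) with hE
  have hEm : ∀ p, Measurable (E p) := fun p =>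
    ((measurable_pi_apply _).comp (measurable_pi_apply _)).sub_const _
  set U : Finset (UpperPairs n) := Finset.univ.filter fun p => p.1.1 ∈ S ∧ p.1.2 ∈ S with hU
  have hind : IndepFun (fun A (p : ↥U) => E p A) (fun A (p : ↥Uᶜ) => E p A) P :=
    iIndepFun.indepFun_finset U Uᶜ disjoint_compl_right hP.indep hEm
  -- Rebuilds the submatrix on `S` from its entries above the diagonal, using symmetry and the zero
  -- diagonal; the localization is thus almost surely a function of the noise indexed by `U`.
  set Φ : (↥U → ℝ) → ↥S → ↥S → ℝ := fun e a b =>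
    if h : (a : Fin n) < b then e ⟨⟨(a, b), h⟩, by simp [hU]⟩ + f (x a) (x b)
    else if h : (b : Fin n) < a then e ⟨⟨(b, a), h⟩, by simp [hU]⟩ + f (x b) (x a) else 0 with hΦ
  have hΦm : Measurable Φ := by
    refine measurable_pi_lambda _ fun a => measurable_pi_lambda _ fun b => ?_
    simp only [hΦ]
    split_ifs
    · exact (measurable_pi_apply _).add_const _
    · exact (measurable_pi_apply _).add_const _
    · exact measurable_const
  have hΦM : ∀ᵐ M ∂P, Φ (fun p => E p M) = fun a b : ↥S => M a b := by
    filter_upwards [hP.symm, hP.diag] with M hs hd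
    funext a b
    simp only [hΦ, hE]
    split_ifs with h1 h2
    · ring
    · rw [hs a b]; ring
    · rw [le_antisymm (not_lt.1 h2) (not_lt.1 h1), hd]
  have hfin := finite_regularPositions ↥S
  set D : (↥S → Circle) → Set (Fin n → Fin n → ℝ) :=
    fun v => {M | g (Φ fun p => E p M) = v} with hD
  set N : (↥S → Circle) → Set (Fin n → Fin n → ℝ) :=
    fun v => {M | Exceeds t (rowWeights i z z' v) fun i j => M i j - f (x i) (x j)} with hN
  have hDm : ∀ v, MeasurableSet (D v) := fun v =>
    (hg.comp (hΦm.comp (measurable_pi_lambda _ fun p => hEm p))) (measurableSet_singleton v)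
  have hind' : ∀ v, P (D v ∩ N v) = P (D v) * P (N v) := by
    intro v
    set V : Set (↥Uᶜ → ℝ) := {e | t * √(∑ p : UpperPairs n, rowWeights i z z' v p.1.1 p.1.2 ^ 2)
      < ∑ p : ↥Uᶜ, rowWeights i z z' v p.1.1.1 p.1.1.2 * e p} with hV
    have hVm : MeasurableSet V := by
      refine measurableSet_lt measurable_const (Finset.measurable_sum _ fun p _ => ?_)
      exact (measurable_pi_apply p).const_mul _
    -- The weights vanish on pairs inside `S` because `i ∉ S`, so this event involves only the noise
    -- outside `U`.
    have hNV : N v = (fun A (p : ↥Uᶜ) => E p A) ⁻¹' V := by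
      ext M
      simp only [hN, hV, mem_ofPred_eq, Exceeds, mem_preimage]
      have : ∑ p : UpperPairs n, rowWeights i z z' v p.1.1 p.1.2
          * (M p.1.1 p.1.2 - f (x p.1.1) (x p.1.2))
          = ∑ p : ↥Uᶜ, rowWeights i z z' v p.1.1.1 p.1.1.2 * E p M := by
        rw [Finset.sum_coe_sort Uᶜ fun p => rowWeights i z z' v p.1.1 p.1.2 * E p M]
        refine (Finset.sum_subset (Finset.subset_univ _) fun p _ hp => ?_).symm
        have hp' : p.1.1 ∈ S ∧ p.1.2 ∈ S := by simpa [hU] using hp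
        have h1 : p.1.1 ≠ i := fun h => hi (h ▸ hp'.1)
        have h2 : p.1.2 ≠ i := fun h => hi (h ▸ hp'.2)
        simp [rowWeights, h1, h2]
      rw [this]
    rw [hNV]
    exact hind.measure_inter_preimage_eq_mul (g ∘ Φ ⁻¹' {v}) V
      ((hg.comp hΦm) (measurableSet_singleton v)) hVm
  have hsubset : {M | Exceeds t (rowWeights i z z' (g fun a b => M a b))
      fun i j => M i j - f (x i) (x j)} ≤ᵐ[P] ⋃ v ∈ hfin.toFinset, D v ∩ N v := by
    filter_upwards [hΦM] with M hM h
    refine mem_biUnion (x := g fun a b => M a b) (by simpa using hgmem _) ⟨?_, h⟩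
    simp only [hD, mem_ofPred_eq, hM]
  have hreal : ∀ v, P.real (D v ∩ N v) = P.real (D v) * P.real (N v) := fun v => by
    simp only [measureReal_def, hind', ENNReal.toReal_mul]
  calc P.real {M | Exceeds t (rowWeights i z z' (g fun a b => M a b))
        fun i j => M i j - f (x i) (x j)}
      ≤ P.real (⋃ v ∈ hfin.toFinset, D v ∩ N v) :=
        ENNReal.toReal_mono (measure_ne_top _ _) (measure_mono_ae hsubset)
    _ ≤ ∑ v ∈ hfin.toFinset, P.real (D v ∩ N v) := measureReal_biUnion_finset_le _ _
    _ ≤ ∑ v ∈ hfin.toFinset, P.real (D v) * Real.exp (-t ^ 2 / 2) := by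
        refine Finset.sum_le_sum fun v _ => ?_
        rw [hreal]
        gcongr
        exact hP.subGaussian _ t ht
    -- The events `D v` are disjoint, so their probabilities add up to at most `1` and the number of
    -- possible localizations does not enter.
    _ = P.real (⋃ v ∈ hfin.toFinset, D v) * Real.exp (-t ^ 2 / 2) := by
        rw [← Finset.sum_mul, measureReal_biUnion_finset _ fun v _ => hDm v]
        intro v _ w _ hvw
        refine disjoint_left.2 fun M hv hw => hvw ?_
        exact hv.symm.trans hw
    _ ≤ 1 * Real.exp (-t ^ 2 / 2) := by
        gcongr
        exact measureReal_le_one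
    _ = _ := one_mul _

theorem measureReal_largeNoiseRefine_le {n : ℕ} {f : Circle → Circle → ℝ} {x : Fin n → Circle}
    {P : Measure (Fin n → Fin n → ℝ)} [IsProbabilityMeasure P] (hP : IsModelLaw f x P) (k : ℕ)
    {S : Finset (Fin n)} {g : (↥S → ↥S → ℝ) → ↥S → Circle} (hg : Measurable g)
    (hgmem : ∀ M, g M ∈ regularPositions ↥S) {t : ℝ} (ht : 0 ≤ t) :
    P.real {M | LargeNoiseRefine k t (g fun a b => M a b) fun i j => M i j - f (x i) (x j)}
      ≤ n * (k : ℝ) ^ 2 * Real.exp (-t ^ 2 / 2) := by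
  classical
  have hfin : ((Set.univ : Set (Fin n)) ×ˢ grid k ×ˢ grid k).Finite :=
    finite_univ.prod ((finite_grid k).prod (finite_grid k))
  have hsubset : {M : Fin n → Fin n → ℝ | LargeNoiseRefine k t (g fun a b => M a b)
      fun i j => M i j - f (x i) (x j)} ⊆ ⋃ q ∈ hfin.toFinset,
        {M | q.1 ∉ S ∧ Exceeds t (rowWeights q.1 q.2.1 q.2.2 (g fun a b => M a b))
          fun i j => M i j - f (x i) (x j)} := by
    rintro M ⟨q, hq, h⟩
    exact mem_biUnion (by simpa using hq) h
  refine (measureReal_mono hsubset (measure_ne_top _ _)).trans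
    ((measureReal_biUnion_finset_le _ _).trans ?_)
  refine (Finset.sum_le_sum (g := fun _ => Real.exp (-t ^ 2 / 2)) fun q _ => ?_).trans ?_
  · by_cases hq : q.1 ∈ S
    · simp only [hq, not_true_eq_false, false_and]
      simp [Real.exp_nonneg]
    · simp only [hq, not_false_eq_true, true_and]
      exact measureReal_exceeds_rowWeights_le hP hg hgmem hq _ _ ht
  rw [Finset.sum_const, nsmul_eq_mul]
  gcongr
  rw [← ncard_eq_toFinset_card _ hfin, ncard_prod, ncard_prod, ncard_univ, Nat.card_eq_fintype_card,
    Fintype.card_fin, Nat.cast_mul, Nat.cast_mul, sq]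
  have h' : ((grid k).ncard : ℝ) ≤ k := by exact_mod_cast ncard_grid_le k
  gcongr

/-! ### Rates -/

/-- The rate `√(log n / n)`. -/
def rate (n : ℕ) : ℝ := √(Real.log n / n)

theorem one_le_log {n : ℕ} (hn : 4 ≤ n) : 1 ≤ Real.log n := by
  have hn' : (4 : ℝ) ≤ n := by exact_mod_cast hn
  rw [Real.le_log_iff_exp_le (by linarith)]
  linarith [Real.exp_one_lt_d9]

theorem rate_sq {n : ℕ} (hn : 4 ≤ n) : rate n ^ 2 = Real.log n / n := by
  rw [rate, Real.sq_sqrt]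
  have := one_le_log hn
  positivity

theorem inv_le_rate {n : ℕ} (hn : 4 ≤ n) : 1 / (n : ℝ) ≤ rate n := by
  have hn' : (4 : ℝ) ≤ n := by exact_mod_cast hn
  have hl := one_le_log hn
  apply Real.le_sqrt_of_sq_le
  rw [div_pow, one_pow, div_le_div_iff₀ (by positivity) (by positivity)]
  nlinarith

theorem one_le_four_mul_rate_mul {n : ℕ} (hn : 4 ≤ n) {K : ℝ} (hK : (n : ℝ) / 4 ≤ K) :
    1 ≤ 4 * (rate n * K) := by
  have hn' : (4 : ℝ) ≤ n := by exact_mod_cast hn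
  have h1 := inv_le_rate hn
  have hr : 0 ≤ rate n := Real.sqrt_nonneg _
  calc (1 : ℝ) = 4 * (1 / n * (n / 4)) := by field_simp
    _ ≤ 4 * (rate n * K) := by gcongr

/-- Since `K ≥ n / 4`, the square `c² K² log n / n` is at least `c² K log n / 4`. -/
theorem sqrt_mul_log_le {n : ℕ} (hn : 4 ≤ n) {K b c : ℝ} (hK : (n : ℝ) / 4 ≤ K) (hc : 0 ≤ c)
    (hbc : 4 * b ≤ c ^ 2) : √(b * K * Real.log n) ≤ c * (rate n * K) := by
  have hn' : (4 : ℝ) ≤ n := by exact_mod_cast hn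
  have hl := one_le_log hn
  have hr : 0 ≤ rate n := Real.sqrt_nonneg _
  have hK0 : 0 < K := by linarith
  apply Real.sqrt_le_iff.2 ⟨by positivity, ?_⟩
  have h1 : (c * (rate n * K)) ^ 2 = c ^ 2 * (Real.log n / n) * K ^ 2 := by
    rw [← rate_sq hn]; ring
  rw [h1]
  have h2 : (n : ℝ) * b ≤ c ^ 2 * K := by nlinarith [sq_nonneg c]
  calc b * K * Real.log n = n * b * (K * (Real.log n / n)) := by field_simp
    _ ≤ c ^ 2 * K * (K * (Real.log n / n)) := by gcongr
    _ = _ := by ring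

theorem spread_radius_le {n : ℕ} (hn : 4 ≤ n) {K : ℝ} (hK : (n : ℝ) / 4 ≤ K) :
    2 * Real.pi * ((√(2 * K * Real.log n) + 1) / K) ≤ 14 * Real.pi * rate n := by
  have hn' : (4 : ℝ) ≤ n := by exact_mod_cast hn
  have hK0 : 0 < K := by linarith
  have h1 := sqrt_mul_log_le hn hK (b := 2) (c := 3) (by norm_num) (by norm_num)
  have h2 := one_le_four_mul_rate_mul hn hK
  have hp := Real.pi_pos
  calc 2 * Real.pi * ((√(2 * K * Real.log n) + 1) / K)
      -- The `7` is `3` for the square root plus `4` for the added `1`.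
      ≤ 2 * Real.pi * (7 * (rate n * K) / K) := by gcongr; linarith
    _ = _ := by field_simp; ring

theorem exp_neg_mul_log {n : ℕ} (hn : 4 ≤ n) (m : ℕ) :
    Real.exp (-(m * Real.log n)) = 1 / (n : ℝ) ^ m := by
  have hn' : (0 : ℝ) < n := by exact_mod_cast (by omega : 0 < n)
  rw [Real.exp_neg, Real.exp_nat_mul, Real.exp_log hn', one_div]

/-! ### Accuracy of the refined localization on the complement of the sample -/

/-- The constant in the average error bound of the initial localization. -/
def initConst (cl cL ce : ℝ) : ℝ :=
  14 * Real.pi + 2 * Real.pi / cl * (28 * Real.pi * cL + 3 * ce + 16)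

/-- The constant in the error bound of the refined localization. -/
def refineConst (cl cL ce : ℝ) : ℝ :=
  8 * Real.pi + Real.pi ^ 2 / cl * (7 + 8 * Real.pi * cL + cL * initConst cl cL ce + 3 * ce)

theorem initConst_nonneg {cl cL ce : ℝ} (hcl : 0 < cl) (hcL : 0 ≤ cL) (hce : 0 ≤ ce) :
    0 ≤ initConst cl cL ce := by
  have := Real.pi_pos
  unfold initConst
  positivity

theorem refineConst_nonneg {cl cL ce : ℝ} (hcl : 0 < cl) (hcL : 0 ≤ cL) (hce : 0 ≤ ce) :
    0 ≤ refineConst cl cL ce := by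
  have := Real.pi_pos
  have := initConst_nonneg hcl hcL hce
  unfold refineConst
  positivity

theorem exists_orth_geoDist_refined_le {n : ℕ} (hn4 : 4 ∣ n) (hn : 12 ≤ n) {cl cL ce : ℝ}
    {f : Circle → Circle → ℝ} (hf : IsBiLipschitz n cl cL ce f) (hcl : 0 < cl) (hcL : 0 ≤ cL)
    (hce : 0 ≤ ce) {S : Finset (Fin n)} (hS : S.card = n / 4) {x : Fin n → Circle}
    (hx : IsSpread √(2 * (S.card : ℝ) * Real.log n) fun i : ↥S => x i)
    (est : InitialEstimator n) {M : Fin n → Fin n → ℝ} (hM : ∀ i j, M i j = M j i)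
    (h1 : ¬ LargeNoiseInit S (2 * n * rate n) fun i j => M i j - f (x i) (x j))
    (h2 : ¬ LargeNoiseRefine (n / 4) √(10 * Real.log n) (est.est S fun i j => M i j)
      fun i j => M i j - f (x i) (x j)) {x2 : Fin n → Circle}
    (hx2 : IsRefined M S (est.est S fun i j => M i j) x2) :
    ∃ P : Orth, ∀ i, i ∉ S → geoDist (x2 i) (rot P (x i)) ≤ refineConst cl cL ce * rate n := by
  have hp := Real.pi_pos
  have hk3 : 3 ≤ n / 4 := by omega
  have hkn : (n : ℝ) = 4 * ((n / 4 : ℕ) : ℝ) := by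
    have : n = 4 * (n / 4) := by omega
    exact_mod_cast this
  have hcard : Fintype.card ↥S = n / 4 := by rw [Fintype.card_coe, hS]
  have hcard3 : 3 ≤ Fintype.card ↥S := by omega
  have hW : ∀ i j, M i j - f (x i) (x j) = M j i - f (x j) (x i) := fun i j => by
    rw [hM, hf.symm]
  have hr0 : 0 ≤ rate n := Real.sqrt_nonneg _
  have hK : (n : ℝ) / 4 ≤ ((n / 4 : ℕ) : ℝ) := by linarith
  have hradius := spread_radius_le (by omega : 4 ≤ n) hK
  have hone := one_le_four_mul_rate_mul (by omega : 4 ≤ n) hK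
  obtain ⟨xr, hxr, hxxr⟩ := hx.exists_regularPositions
  rw [hS, hcard] at hxxr
  replace hxxr := fun i => (hxxr i).trans hradius
  set xh := est.est S fun i j => M i j with hxh
  have hxhmem : xh ∈ regularPositions ↥S := est.mem_regular _ _
  obtain ⟨P, hP⟩ := exists_orth_sum_geoDist_le hcard3 hf hcl hcL hce
    (t := 2 * (2 * n * rate n)) (by positivity) (by positivity) hxr hxxr hxhmem (est.isMin _ _)
    (neg_le_sum_of_not_largeNoiseInit (by positivity) hW h1 hxhmem hxr)
  refine ⟨P, fun i hi => ?_⟩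
  rw [hcard] at hP
  generalize hk : ((n / 4 : ℕ) : ℝ) = k at *
  have hkpos : 0 < k := by
    have : (0 : ℝ) < (n / 4 : ℕ) := by exact_mod_cast (by omega : 0 < n / 4)
    rwa [hk] at this
  have hP' : ∑ j : ↥S, geoDist (rot P (x j)) (xh j) ≤ initConst cl cL ce * (rate n * k) := by
    change _ ≤ k * _ + 2 * Real.pi / cl * ((_ + 3 * (ce * rate n)) * k + _) at hP
    refine hP.trans (le_of_eq ?_)
    -- The `16` in `initConst` is the noise term `4 n rate` with `n = 4 k`; `28 π cL` is `2 cL`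
    -- times the radius `14 π`.
    rw [initConst, hkn]
    ring
  have hfin := geoDist_refined_le hcard hk3 hf hcl hcL hce hxhmem
    (Real.sqrt_nonneg (10 * Real.log n)) hP' (hx2 i hi).1 (hx2 i hi).2
    (fun z hz => neg_le_sum_of_not_largeNoiseRefine hW h2 hi (hx2 i hi).1 hz)
  rw [hk] at hfin
  refine hfin.trans ?_
  have ht : √(10 * Real.log n) * √k ≤ 7 * (rate n * k) := by
    rw [← Real.sqrt_mul' _ hkpos.le]
    have := sqrt_mul_log_le (by omega : 4 ≤ n) hK (b := 10) (c := 7) (by norm_num) (by norm_num)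
    rwa [mul_right_comm] at this
  have hi1 : 2 * Real.pi / k ≤ 8 * Real.pi * rate n := by
    rw [div_le_iff₀ hkpos]
    nlinarith
  have hi2 : cL * (2 * Real.pi) ≤ 8 * Real.pi * cL * (rate n * k) := by
    have : cL * (2 * Real.pi) * 1 ≤ cL * (2 * Real.pi) * (4 * (rate n * k)) := by gcongr
    linarith
  have hi3 : √(10 * Real.log n) * √k + cL * (2 * Real.pi) + cL * (initConst cl cL ce * (rate n * k))
      + 3 * (ce * √(Real.log n / n)) * k
      ≤ (7 + 8 * Real.pi * cL + cL * initConst cl cL ce + 3 * ce) * (rate n * k) := by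
    change _ + 3 * (ce * rate n) * k ≤ _
    linarith
  calc _ ≤ 8 * Real.pi * rate n + Real.pi ^ 2 / (cl * k) *
        ((7 + 8 * Real.pi * cL + cL * initConst cl cL ce + 3 * ce) * (rate n * k)) := by gcongr
    _ = _ := by rw [refineConst]; field_simp

/-! ### Failure events -/

/-- Some good event fails, for the split `(S, S')`, the latent positions `x`, the observations `M`
and the noise `W`. -/
def Failure {n : ℕ} (init init' : InitialEstimator n) (S S' : Finset (Fin n))
    (x : Fin n → Circle) (M W : Fin n → Fin n → ℝ) : Prop :=
  (¬ IsSpread √(2 * (S.card : ℝ) * Real.log n) fun i : ↥S => x i) ∨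
  (¬ IsSpread √(2 * (S'.card : ℝ) * Real.log n) fun i : ↥S' => x i) ∨
  (¬ IsSpread √(2 * ((Sᶜ ∩ S'ᶜ).card : ℝ) * Real.log n) fun i : ↥(Sᶜ ∩ S'ᶜ) => x i) ∨
  LargeNoiseInit S (2 * n * rate n) W ∨
  LargeNoiseInit S' (2 * n * rate n) W ∨
  LargeNoiseRefine (n / 4) √(10 * Real.log n) (init.est S fun i j => M i j) W ∨
  LargeNoiseRefine (n / 4) √(10 * Real.log n) (init'.est S' fun i j => M i j) W

theorem orthDist_le_of_not_failure {n : ℕ} (hn4 : 4 ∣ n) (hn : 12 ≤ n)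
    (hrate : 56 * Real.pi * rate n ≤ 1) {cl cL ce : ℝ}
    {f : Circle → Circle → ℝ} (hf : IsBiLipschitz n cl cL ce f) (hcl : 0 < cl) (hcL : 0 ≤ cL)
    (hce : 0 ≤ ce) {init init' : InitialEstimator n} {S S' : Finset (Fin n)}
    (hS : S.card = n / 4) (hSS' : S' ⊆ Sᶜ) (hS' : S'.card = n / 4)
    {x xhat : Fin n → Circle} {M : Fin n → Fin n → ℝ} (hM : ∀ i j, M i j = M j i)
    (hgood : ¬ Failure init init' S S' x M fun i j => M i j - f (x i) (x j))
    (hout : IsOutput init init' M S S' xhat) :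
    orthDist xhat x ≤ (1 + 8 * Real.pi) * (refineConst cl cL ce * rate n) := by
  simp only [Failure, not_or, not_not] at hgood
  obtain ⟨hs, hs', hsT, h1, h1', h2, h2'⟩ := hgood
  obtain ⟨x2, x2', Q, hx2, hx2', hQ, hxhat⟩ := hout
  obtain ⟨P, hP⟩ := exists_orth_geoDist_refined_le hn4 hn hf hcl hcL hce hS hs init hM h1 h2 hx2
  obtain ⟨P', hP'⟩ :=
    exists_orth_geoDist_refined_le hn4 hn hf hcl hcL hce hS' hs' init' hM h1' h2' hx2'
  have hT : n / 4 ≤ (Sᶜ ∩ S'ᶜ).card := by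
    rw [← Finset.compl_union, Finset.card_compl, Fintype.card_fin]
    have := Finset.card_union_le S S'
    omega
  have hK : (n : ℝ) / 4 ≤ ((Sᶜ ∩ S'ᶜ).card : ℝ) := by
    have : n ≤ 4 * (Sᶜ ∩ S'ᶜ).card := by omega
    have : (n : ℝ) ≤ 4 * ((Sᶜ ∩ S'ᶜ).card : ℝ) := by exact_mod_cast this
    linarith
  obtain ⟨xr, hxr, hxxr⟩ := hsT.exists_regularPositions
  refine orthDist_output_le hSS' (by omega) hP hP' hQ hxhat hxr
    (fun i => (hxxr i).trans ?_) (ρ := 14 * Real.pi * rate n) (by linarith)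
  rw [Fintype.card_coe]
  exact spread_radius_le (by omega) hK

theorem measurableSet_isSpread_coe {n : ℕ} {α : Type*} [MeasurableSpace α] (S : Finset (Fin n))
    (s : ℝ) {x : α → Fin n → Circle} (hx : Measurable x) :
    MeasurableSet {q | IsSpread s fun i : ↥S => x q i} :=
  (measurable_pi_lambda (fun q (i : ↥S) => x q i) fun _ => (measurable_pi_apply _).comp hx)
    (measurableSet_isSpread s)

theorem measurableSet_largeNoiseInit {n : ℕ} {α : Type*} [MeasurableSpace α] (S : Finset (Fin n))
    (t : ℝ) {W : α → Fin n → Fin n → ℝ} (hW : ∀ i j, Measurable fun q => W q i j) :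
    MeasurableSet {q | LargeNoiseInit S t (W q)} := by
  have hfin := (finite_regularPositions ↥S).prod (finite_regularPositions ↥S)
  have : {q | LargeNoiseInit S t (W q)} = ⋃ v ∈ regularPositions ↥S ×ˢ regularPositions ↥S,
      {q | Exceeds t (pairWeights v.1 v.2) (W q)} := by
    ext q
    simp only [LargeNoiseInit, mem_ofPred_eq, mem_iUnion, exists_prop]
  rw [this]
  exact hfin.measurableSet_biUnion fun v _ =>
    measurableSet_exceeds t (fun _ _ => measurable_const) fun i j _ => hW i j

theorem measurableSet_largeNoiseRefine {n : ℕ} {α : Type*} [MeasurableSpace α] (k : ℕ)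
    {S : Finset (Fin n)} (t : ℝ) {y : α → ↥S → Circle} (hy : Measurable y)
    {W : α → Fin n → Fin n → ℝ} (hW : ∀ i j, Measurable fun q => W q i j) :
    MeasurableSet {q | LargeNoiseRefine k t (y q) (W q)} := by
  have hfin : ((Set.univ : Set (Fin n)) ×ˢ grid k ×ˢ grid k).Finite :=
    finite_univ.prod ((finite_grid k).prod (finite_grid k))
  have : {q | LargeNoiseRefine k t (y q) (W q)}
      = ⋃ v ∈ (Set.univ : Set (Fin n)) ×ˢ grid k ×ˢ grid k,
        {_q | v.1 ∉ S} ∩ {q | Exceeds t (rowWeights v.1 v.2.1 v.2.2 (y q)) (W q)} := by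
    ext q
    simp only [LargeNoiseRefine, mem_ofPred_eq, mem_iUnion, exists_prop, mem_inter_iff]
  rw [this]
  refine hfin.measurableSet_biUnion fun v _ => (MeasurableSet.const _).inter
    (measurableSet_exceeds t (fun a b => ?_) fun i j _ => hW i j)
  exact (measurable_rowWeights _ _ _ a b).comp hy

theorem measurableSet_failure {n : ℕ} {α : Type*} [MeasurableSpace α]
    (init init' : InitialEstimator n) (S S' : Finset (Fin n)) {x : α → Fin n → Circle}
    (hx : Measurable x) {M W : α → Fin n → Fin n → ℝ} (hM : Measurable M)
    (hW : ∀ i j, Measurable fun q => W q i j) :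
    MeasurableSet {q | Failure init init' S S' (x q) (M q) (W q)} := by
  have hsub : ∀ T : Finset (Fin n), Measurable fun q (i j : ↥T) => M q i j := fun T =>
    measurable_pi_lambda _ fun i => measurable_pi_lambda _ fun j =>
      (measurable_pi_apply (j : Fin n)).comp ((measurable_pi_apply (i : Fin n)).comp hM)
  exact (measurableSet_isSpread_coe _ _ hx).compl.union
    ((measurableSet_isSpread_coe _ _ hx).compl.union
    ((measurableSet_isSpread_coe _ _ hx).compl.union
    ((measurableSet_largeNoiseInit _ _ hW).union
    ((measurableSet_largeNoiseInit _ _ hW).union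
    ((measurableSet_largeNoiseRefine _ _ ((init.measurable_est S).comp (hsub S)) hW).union
    (measurableSet_largeNoiseRefine _ _ ((init'.measurable_est S').comp (hsub S')) hW))))))

/-! ### Probability of failure -/

theorem measureReal_not_isSpread_coe_le {Ω : Type*} [MeasurableSpace Ω] {μ : Measure Ω}
    [IsProbabilityMeasure μ] {n : ℕ} (hn : 4 ≤ n) {x : Ω → Fin n → Circle} (hx : Measurable x)
    (hind : iIndepFun (fun i ω => x ω i) μ)
    (hlaw : ∀ i, μ.map (fun ω => x ω i) = uniformCircle) {T : Finset (Fin n)} (hT : 0 < T.card)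
    (hTn : T.card + 1 ≤ n) :
    μ.real {ω | ¬ IsSpread √(2 * (T.card : ℝ) * Real.log n) fun i : ↥T => x ω i}
      ≤ 1 / (n : ℝ) ^ 2 := by
  have hn' : (4 : ℝ) ≤ n := by exact_mod_cast hn
  have hl := one_le_log hn
  have : Nonempty ↥T := (Finset.card_pos.1 hT).to_subtype
  have hT' : (0 : ℝ) < T.card := by exact_mod_cast hT
  refine (measureReal_not_isSpread_le (μ := μ) (x := fun (i : ↥T) ω => x ω i)
    (fun i => (measurable_pi_apply _).comp hx) (hind.precomp Subtype.val_injective)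
    (fun i => hlaw i) (Real.sqrt_nonneg _)).trans ?_
  rw [Fintype.card_coe, Real.sq_sqrt (by positivity)]
  -- With `s² = 2 |T| log n` each arc fails with probability at most `2 / n⁴`; `|T| + 1 ≤ n` arcs
  -- and `2 ≤ n` leave `1 / n²`.
  have h1 : -(2 * (2 * (T.card : ℝ) * Real.log n) / T.card) = -((4 : ℕ) * Real.log n) := by
    field_simp
    norm_num
  rw [h1, exp_neg_mul_log hn]
  have h2 : (T.card : ℝ) + 1 ≤ n := by exact_mod_cast hTn
  calc ((T.card : ℝ) + 1) * (2 * (1 / (n : ℝ) ^ 4)) ≤ n * (n * (1 / (n : ℝ) ^ 4)) := by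
        gcongr
        linarith
    _ = _ := by field_simp

theorem measureReal_largeNoiseInit_le_inv_sq {n : ℕ} (hn : 4 ≤ n) {f : Circle → Circle → ℝ}
    {x : Fin n → Circle} {P : Measure (Fin n → Fin n → ℝ)} [IsProbabilityMeasure P]
    (hP : IsModelLaw f x P) {S : Finset (Fin n)} (hS : S.card = n / 4) :
    P.real {M | LargeNoiseInit S (2 * n * rate n) fun i j => M i j - f (x i) (x j)}
      ≤ 1 / (n : ℝ) ^ 2 := by
  have hn' : (4 : ℝ) ≤ n := by exact_mod_cast hn
  have hr : 0 ≤ rate n := Real.sqrt_nonneg _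
  refine (measureReal_largeNoiseInit_le hP S (by positivity)).trans ?_
  -- This level gives `n ^ (-2n)`, which beats the `k ^ (2k)` pairs of tuples since `2k ≤ 2n - 2`.
  have h1 : -(2 * n * rate n) ^ 2 / 2 = -((2 * n : ℕ) * Real.log n) := by
    rw [mul_pow, rate_sq hn]
    push_cast
    field_simp
  rw [h1, exp_neg_mul_log hn, ← pow_mul]
  have hk : (S.card : ℝ) ≤ n := by
    exact_mod_cast (by omega : S.card ≤ n)
  calc (S.card : ℝ) ^ (S.card * 2) * (1 / (n : ℝ) ^ (2 * n))
      ≤ (n : ℝ) ^ (S.card * 2) * (1 / (n : ℝ) ^ (2 * n)) := by gcongr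
    _ ≤ (n : ℝ) ^ (2 * n - 2) * (1 / (n : ℝ) ^ (2 * n)) := by
        gcongr
        · linarith
        · omega
    _ = 1 / (n : ℝ) ^ 2 := by
        have : (n : ℝ) ^ (2 * n) = (n : ℝ) ^ (2 * n - 2) * (n : ℝ) ^ 2 := by
          rw [← pow_add]; congr 1; omega
        rw [this]
        field_simp

theorem measureReal_largeNoiseRefine_le_inv_sq {n : ℕ} (hn : 4 ≤ n) {f : Circle → Circle → ℝ}
    {x : Fin n → Circle} {P : Measure (Fin n → Fin n → ℝ)} [IsProbabilityMeasure P]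
    (hP : IsModelLaw f x P) (S : Finset (Fin n)) (init : InitialEstimator n) :
    P.real {M | LargeNoiseRefine (n / 4) √(10 * Real.log n) (init.est S fun i j => M i j)
      fun i j => M i j - f (x i) (x j)} ≤ 1 / (n : ℝ) ^ 2 := by
  have hn' : (4 : ℝ) ≤ n := by exact_mod_cast hn
  have hl := one_le_log hn
  refine (measureReal_largeNoiseRefine_le hP _ (init.measurable_est S) (init.mem_regular S)
    (Real.sqrt_nonneg _)).trans ?_
  -- Level `√(10 log n)` gives `n⁻⁵` for each of at most `n³` directions.
  have h1 : -√(10 * Real.log n) ^ 2 / 2 = -((5 : ℕ) * Real.log n) := by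
    rw [Real.sq_sqrt (by positivity)]
    push_cast
    ring
  rw [h1, exp_neg_mul_log hn]
  have hk : ((n / 4 : ℕ) : ℝ) ≤ n := by exact_mod_cast (by omega : n / 4 ≤ n)
  calc (n : ℝ) * ((n / 4 : ℕ) : ℝ) ^ 2 * (1 / (n : ℝ) ^ 5) ≤ n * n ^ 2 * (1 / (n : ℝ) ^ 5) := by
        gcongr
    _ = _ := by field_simp

/-- The probability of an event on a pair is bounded through the conditional distributions. -/
theorem measureReal_le_of_condDistrib {Ω α β : Type*} [MeasurableSpace Ω] [MeasurableSpace α]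
    [MeasurableSpace β] [StandardBorelSpace β] [Nonempty β] {μ : Measure Ω}
    [IsProbabilityMeasure μ] {X : Ω → α} {Y : Ω → β} (hX : Measurable X) (hY : Measurable Y)
    {N : Set (α × β)} (hN : MeasurableSet N) {c : ℝ} (hc : 0 ≤ c)
    (h : ∀ᵐ a ∂(μ.map X), (condDistrib Y X μ a).real {b | (a, b) ∈ N} ≤ c) :
    μ.real {ω | (X ω, Y ω) ∈ N} ≤ c := by
  have : IsProbabilityMeasure (μ.map X) := Measure.isProbabilityMeasure_map hX.aemeasurable
  refine ENNReal.toReal_le_of_le_ofReal hc ?_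
  have h1 : μ {ω | (X ω, Y ω) ∈ N} = (μ.map fun ω => (X ω, Y ω)) N :=
    (Measure.map_apply (hX.prodMk hY) hN).symm
  rw [h1, ← compProd_map_condDistrib hY.aemeasurable, Measure.compProd_apply hN]
  calc ∫⁻ a, condDistrib Y X μ a (Prod.mk a ⁻¹' N) ∂(μ.map X)
      ≤ ∫⁻ _, ENNReal.ofReal c ∂(μ.map X) := by
        refine lintegral_mono_ae ?_
        filter_upwards [h] with a ha
        exact (ENNReal.le_ofReal_iff_toReal_le (measure_ne_top _ _) hc).2 ha
    _ = ENNReal.ofReal c := by simp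

/-- An event that depends on an independent random choice is bounded by its worst probability. -/
theorem measureReal_le_of_indepFun {Ω α β : Type*} [MeasurableSpace Ω] [MeasurableSpace α]
    [MeasurableSpace β] [Fintype α] [MeasurableSingletonClass α] {μ : Measure Ω}
    [IsProbabilityMeasure μ] {U : Ω → α} {Y : Ω → β} (hU : Measurable U) (hind : IndepFun U Y μ)
    {V : Set α} (hV : ∀ᵐ ω ∂μ, U ω ∈ V) {N : α → Set β} (hN : ∀ u, MeasurableSet (N u)) {c : ℝ}
    (hc : 0 ≤ c) (h : ∀ u ∈ V, μ.real (Y ⁻¹' N u) ≤ c) :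
    μ.real {ω | Y ω ∈ N (U ω)} ≤ c := by
  classical
  have hsubset : {ω | Y ω ∈ N (U ω)} ≤ᵐ[μ]
      ⋃ u ∈ Finset.univ.filter fun u => u ∈ V, U ⁻¹' {u} ∩ Y ⁻¹' N u := by
    filter_upwards [hV] with ω hω h'
    exact mem_biUnion (x := U ω) (by simpa using hω) ⟨rfl, h'⟩
  have hreal : ∀ u, μ.real (U ⁻¹' {u} ∩ Y ⁻¹' N u) = μ.real (U ⁻¹' {u}) * μ.real (Y ⁻¹' N u) :=
    fun u => by
      simp only [measureReal_def, hind.measure_inter_preimage_eq_mul _ _ (measurableSet_singleton u)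
        (hN u), ENNReal.toReal_mul]
  calc μ.real {ω | Y ω ∈ N (U ω)}
      ≤ μ.real (⋃ u ∈ Finset.univ.filter fun u => u ∈ V, U ⁻¹' {u} ∩ Y ⁻¹' N u) :=
        ENNReal.toReal_mono (measure_ne_top _ _) (measure_mono_ae hsubset)
    _ ≤ ∑ u ∈ Finset.univ.filter fun u => u ∈ V, μ.real (U ⁻¹' {u} ∩ Y ⁻¹' N u) :=
        measureReal_biUnion_finset_le _ _
    _ ≤ ∑ u ∈ Finset.univ.filter fun u => u ∈ V, μ.real (U ⁻¹' {u}) * c := by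
        refine Finset.sum_le_sum fun u hu => ?_
        rw [hreal]
        gcongr
        exact h u (by simpa using hu)
    _ = μ.real (⋃ u ∈ Finset.univ.filter fun u => u ∈ V, U ⁻¹' {u}) * c := by
        rw [← Finset.sum_mul, measureReal_biUnion_finset _ fun u _ =>
          hU (measurableSet_singleton u)]
        intro v _ w _ hvw
        refine disjoint_left.2 fun ω hv hw => hvw ?_
        exact hv.symm.trans hw
    _ ≤ 1 * c := by
        gcongr
        exact measureReal_le_one
    _ = c := one_mul c

section

variable {Ω : Type*} [MeasurableSpace Ω] {μ : Measure Ω} [IsProbabilityMeasure μ] {n : ℕ}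
  {f : Circle → Circle → ℝ} {x : Ω → Fin n → Circle} {A : Ω → Fin n → Fin n → ℝ}

/-- The conditional mean of the observations given the latent positions. -/
def condMean (μ : Measure Ω) [IsProbabilityMeasure μ] (x : Ω → Fin n → Circle)
    (A : Ω → Fin n → Fin n → ℝ) (y : Fin n → Circle) (i j : Fin n) : ℝ :=
  ∫ M, M i j ∂(condDistrib A x μ y)

/-- No measurability of `f` is assumed. The conditional mean is a measurable substitute for `f (x i)
(x j)` that makes the failure events measurable on the space of pairs `(x, A)`. -/
theorem measurable_condMean (i j : Fin n) : Measurable fun y => condMean μ x A y i j :=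
  (StronglyMeasurable.integral_kernel (f := fun M : Fin n → Fin n → ℝ => M i j)
    (Measurable.stronglyMeasurable (by fun_prop))).measurable

theorem measurable_noise (i j : Fin n) :
    Measurable fun q : (Fin n → Circle) × (Fin n → Fin n → ℝ) =>
      q.2 i j - condMean μ x A q.1 i j := by
  have h : Measurable fun q : (Fin n → Circle) × (Fin n → Fin n → ℝ) => q.2 i j :=
    (measurable_pi_apply j).comp ((measurable_pi_apply i).comp measurable_snd)
  exact h.sub ((measurable_condMean i j).comp measurable_fst)

theorem ae_symm_of_condDistrib (hx : Measurable x) (hA : Measurable A)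
    (hmodel : ∀ᵐ y ∂(μ.map x), IsModelLaw f y (condDistrib A x μ y)) :
    ∀ᵐ ω ∂μ, ∀ i j, A ω i j = A ω j i := by
  have hent : ∀ i j, Measurable fun q : (Fin n → Circle) × (Fin n → Fin n → ℝ) => q.2 i j :=
    fun i j => (measurable_pi_apply j).comp ((measurable_pi_apply i).comp measurable_snd)
  have hN : MeasurableSet {q : (Fin n → Circle) × (Fin n → Fin n → ℝ) |
      ∀ i j, q.2 i j = q.2 j i} := by
    simp only [ofPred_forall]
    exact MeasurableSet.iInter fun i => MeasurableSet.iInter fun j =>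
      measurableSet_eq_fun (hent i j) (hent j i)
  have h := measureReal_le_of_condDistrib (μ := μ) hx hA hN.compl le_rfl (by
    filter_upwards [hmodel] with y hy
    have h0 : condDistrib A x μ y {M | ¬ ∀ i j, M i j = M j i} = 0 := hy.symm
    exact (by rw [measureReal_def]; exact congrArg ENNReal.toReal h0 : _ = (0 : ℝ)).le)
  rw [ae_iff]
  exact (measureReal_eq_zero_iff (measure_ne_top _ _)).1 (le_antisymm h measureReal_nonneg)

theorem measureReal_failure_le (hn : 4 ≤ n) (hn4 : 4 ∣ n) (hx : Measurable x) (hA : Measurable A)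
    (hind : iIndepFun (fun i ω => x ω i) μ)
    (hlaw : ∀ i, μ.map (fun ω => x ω i) = uniformCircle)
    (hmodel : ∀ᵐ y ∂(μ.map x), IsModelLaw f y (condDistrib A x μ y))
    (init init' : InitialEstimator n) {S S' : Finset (Fin n)} (hS : S.card = n / 4)
    (hSS' : S' ⊆ Sᶜ) (hS' : S'.card = n / 4) :
    μ.real {ω | Failure init init' S S' (x ω) (A ω)
      fun i j => A ω i j - condMean μ x A (x ω) i j} ≤ 7 / (n : ℝ) ^ 2 := by
  have hT : (Sᶜ ∩ S'ᶜ).card = n - (n / 4 + n / 4) := by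
    rw [← Finset.compl_union, Finset.card_compl, Fintype.card_fin, Finset.card_union_of_disjoint,
      hS, hS']
    exact Finset.disjoint_left.2 fun i hi hi' => Finset.mem_compl.1 (hSS' hi') hi
  have hc : 0 ≤ 1 / (n : ℝ) ^ 2 := by positivity
  have hspread : ∀ T : Finset (Fin n), 0 < T.card → T.card + 1 ≤ n →
      μ.real {ω | ¬ IsSpread √(2 * (T.card : ℝ) * Real.log n) fun i : ↥T => x ω i}
        ≤ 1 / (n : ℝ) ^ 2 :=
    fun T h1 h2 => measureReal_not_isSpread_coe_le hn hx hind hlaw h1 h2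
  have hinit : ∀ T : Finset (Fin n), T.card = n / 4 →
      μ.real {ω | LargeNoiseInit T (2 * n * rate n)
        fun i j => A ω i j - condMean μ x A (x ω) i j} ≤ 1 / (n : ℝ) ^ 2 := by
    intro T hT
    refine measureReal_le_of_condDistrib (μ := μ) hx hA
      (N := {q | LargeNoiseInit T (2 * n * rate n) fun i j => q.2 i j - condMean μ x A q.1 i j})
      (measurableSet_largeNoiseInit _ _ measurable_noise) hc ?_
    filter_upwards [hmodel] with y hy
    refine le_trans (le_of_eq ?_) (measureReal_largeNoiseInit_le_inv_sq hn hy hT)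
    congr 1
    ext M
    refine exists_congr fun q => and_congr_right fun _ => exceeds_congr fun i j hij => ?_
    rw [← hy.mean i j hij, condMean]
  have hrefine : ∀ (T : Finset (Fin n)) (e : InitialEstimator n),
      μ.real {ω | LargeNoiseRefine (n / 4) √(10 * Real.log n) (e.est T fun i j => A ω i j)
        fun i j => A ω i j - condMean μ x A (x ω) i j} ≤ 1 / (n : ℝ) ^ 2 := by
    intro T e
    have hsub : Measurable fun (q : (Fin n → Circle) × (Fin n → Fin n → ℝ)) (i j : ↥T) =>
        q.2 i j :=
      measurable_pi_lambda _ fun i => measurable_pi_lambda _ fun j =>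
        (measurable_pi_apply (j : Fin n)).comp
          ((measurable_pi_apply (i : Fin n)).comp measurable_snd)
    refine measureReal_le_of_condDistrib (μ := μ) hx hA
      (N := {q | LargeNoiseRefine (n / 4) √(10 * Real.log n) (e.est T fun i j => q.2 i j)
        fun i j => q.2 i j - condMean μ x A q.1 i j})
      (measurableSet_largeNoiseRefine _ _ ((e.measurable_est T).comp hsub) measurable_noise) hc ?_
    filter_upwards [hmodel] with y hy
    refine le_trans (le_of_eq ?_) (measureReal_largeNoiseRefine_le_inv_sq hn hy T e)
    congr 1
    ext M
    refine exists_congr fun q => and_congr_right fun _ => and_congr_right fun _ =>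
      exceeds_congr fun i j hij => ?_
    rw [← hy.mean i j hij, condMean]
  have hunion : ∀ {p q : Ω → Prop} {a b : ℝ}, μ.real {ω | p ω} ≤ a → μ.real {ω | q ω} ≤ b →
      μ.real {ω | p ω ∨ q ω} ≤ a + b := fun h1 h2 =>
    (measureReal_union_le _ _).trans (add_le_add h1 h2)
  refine (hunion (hspread S (by omega) (by omega)) (hunion (hspread S' (by omega) (by omega))
    (hunion (hspread (Sᶜ ∩ S'ᶜ) (by omega) (by omega)) (hunion (hinit S hS) (hunion (hinit S' hS')
    (hunion (hrefine S init) (hrefine S' init'))))))).trans (le_of_eq ?_)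
  ring

end

theorem ae_mem_splitLaw (n : ℕ) : ∀ᵐ p ∂(splitLaw n),
    p ∈ {p : Finset (Fin n) × Finset (Fin n) |
      p.1.card = n / 4 ∧ p.2 ⊆ p.1ᶜ ∧ p.2.card = n / 4} :=
  ae_cond_mem (Set.toFinite _).measurableSet

end

end CircleLocalization

/-! ### The main theorem -/

open CircleLocalization in
theorem corollary3p3 (cl cL ce : ℝ) (hcl : 0 < cl) (hclL : cl ≤ cL) (hce : 0 ≤ ce) :
    ∃ C : ℝ, 0 < C ∧
      ∀ (n : ℕ), 0 < n → 4 ∣ n →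
      ∀ (f : Circle → Circle → ℝ), CircleLocalization.IsBiLipschitz n cl cL ce f →
      ∀ (init init' : CircleLocalization.InitialEstimator n)
        (Ω : Type*) [MeasurableSpace Ω] (μ : Measure Ω) [IsProbabilityMeasure μ]
        (x : Ω → Fin n → Circle) (A : Ω → Fin n → Fin n → ℝ)
        (S S' : Ω → Finset (Fin n)) (xhat : Ω → Fin n → Circle),
        Measurable x → Measurable A → Measurable S → Measurable S' → Measurable xhat →
        iIndepFun (fun i ω => x ω i) μ →
        (∀ i, μ.map (fun ω => x ω i) = CircleLocalization.uniformCircle) →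
        (∀ᵐ y ∂(μ.map x), CircleLocalization.IsModelLaw f y (condDistrib A x μ y)) →
        μ.map (fun ω => (S ω, S' ω)) = CircleLocalization.splitLaw n →
        IndepFun (fun ω => (S ω, S' ω)) (fun ω => (x ω, A ω)) μ →
        (∀ᵐ ω ∂μ, CircleLocalization.IsOutput init init' (A ω) (S ω) (S' ω) (xhat ω)) →
        1 - 7 / (n : ℝ) ^ 2 ≤
          μ.real {ω | CircleLocalization.orthDist (xhat ω) (x ω)
            ≤ C * Real.sqrt (Real.log n / n)} := by
  have hp := Real.pi_pos
  have hcL : 0 ≤ cL := hcl.le.trans hclL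
  have hR := refineConst_nonneg hcl hcL hce
  -- The term `56 π²` makes the bound exceed the diameter `π` as soon as `56 π rate > 1`; otherwise
  -- the spread radius `14 π rate` is at most `1 / 4`, as synchronization requires.
  refine ⟨(1 + 8 * Real.pi) * refineConst cl cL ce + 56 * Real.pi ^ 2, by positivity, ?_⟩
  intro n hn0 hn4 f hf init init' Ω _ μ _ x A S S' xhat hx hA hS hS' _ hind hlaw hmodel hsplit
    hindS hout
  have hn : 4 ≤ n := Nat.le_of_dvd hn0 hn4
  have hn' : (4 : ℝ) ≤ n := by exact_mod_cast hn
  change _ ≤ μ.real {ω | _ ≤ _ * rate n}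
  have hr : 0 ≤ rate n := Real.sqrt_nonneg _
  rcases lt_or_ge 1 (56 * Real.pi * rate n) with hbig | hsmall
  · have huniv : {ω | orthDist (xhat ω) (x ω) ≤
        ((1 + 8 * Real.pi) * refineConst cl cL ce + 56 * Real.pi ^ 2) * rate n} = univ := by
      refine eq_univ_of_forall fun ω => (orthDist_le_pi _ _).trans ?_
      have h1 : 0 ≤ (1 + 8 * Real.pi) * refineConst cl cL ce * rate n := by positivity
      nlinarith
    rw [huniv, probReal_univ]
    have : 0 ≤ 7 / (n : ℝ) ^ 2 := by positivity
    linarith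
  -- For `n ≤ 11` the rate is at least `1 / 11`, which falls in the trivial case; hence `n / 4 ≥ 3`
  -- and the grids are isotropic.
  have hn12 : 12 ≤ n := by
    by_contra! hlt
    have h12 : (n : ℝ) ≤ 11 := by exact_mod_cast (by omega : n ≤ 11)
    have h1 := inv_le_rate hn
    have h2 : 1 / 11 ≤ 1 / (n : ℝ) := by gcongr
    have h3 := Real.pi_gt_three
    nlinarith
  have hfail : μ.real {ω | (x ω, A ω) ∈ {q : (Fin n → Circle) × (Fin n → Fin n → ℝ) |
      Failure init init' (S ω) (S' ω) q.1 q.2 fun i j => q.2 i j - condMean μ x A q.1 i j}}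
      ≤ 7 / (n : ℝ) ^ 2 := by
    refine measureReal_le_of_indepFun (U := fun ω => (S ω, S' ω)) (Y := fun ω => (x ω, A ω))
      (N := fun u => {q : (Fin n → Circle) × (Fin n → Fin n → ℝ) |
      Failure init init' u.1 u.2 q.1 q.2 fun i j => q.2 i j - condMean μ x A q.1 i j})
      (hS.prodMk hS') hindS
      (ae_of_ae_map (hS.prodMk hS').aemeasurable (hsplit ▸ ae_mem_splitLaw n))
      (fun u => measurableSet_failure init init' _ _ measurable_fst measurable_snd
        measurable_noise) (by positivity) ?_
    rintro ⟨s, s'⟩ ⟨h1, h2, h3⟩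
    exact measureReal_failure_le hn hn4 hx hA hind hlaw hmodel init init' h1 h2 h3
  have hmean : ∀ᵐ ω ∂μ, ∀ i j, i < j → condMean μ x A (x ω) i j = f (x ω i) (x ω j) := by
    refine ae_of_ae_map (p := fun y => ∀ i j, i < j → condMean μ x A y i j = f (y i) (y j))
      hx.aemeasurable ?_
    filter_upwards [hmodel] with y hy
    exact hy.mean
  have hbad : μ.real {ω | orthDist (xhat ω) (x ω) ≤
      ((1 + 8 * Real.pi) * refineConst cl cL ce + 56 * Real.pi ^ 2) * rate n}ᶜ
      ≤ 7 / (n : ℝ) ^ 2 := by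
    refine le_trans (ENNReal.toReal_mono (measure_ne_top _ _) (measure_mono_ae ?_)) hfail
    filter_upwards [hmean, ae_symm_of_condDistrib hx hA hmodel, hout,
      ae_of_ae_map (hS.prodMk hS').aemeasurable (hsplit ▸ ae_mem_splitLaw n)]
      with ω h1 h2 h3 ⟨h4, h5, h6⟩
    refine not_imp_comm.1 fun h7 => ?_
    have h8 : ¬ Failure init init' (S ω) (S' ω) (x ω) (A ω)
        fun i j => A ω i j - f (x ω i) (x ω j) := by
      refine fun h => h7 ?_
      have hinit : ∀ T t, LargeNoiseInit T t (fun i j => A ω i j - f (x ω i) (x ω j)) ↔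
          LargeNoiseInit T t fun i j => A ω i j - condMean μ x A (x ω) i j := fun T t =>
        exists_congr fun q => and_congr_right fun _ => exceeds_congr fun i j hij => by rw [h1 i j hij]
      have hrefine : ∀ (T : Finset (Fin n)) t (y : ↥T → Circle),
          LargeNoiseRefine (n / 4) t y (fun i j => A ω i j - f (x ω i) (x ω j)) ↔
          LargeNoiseRefine (n / 4) t y fun i j => A ω i j - condMean μ x A (x ω) i j := fun T t y =>
        exists_congr fun q => and_congr_right fun _ => and_congr_right fun _ =>
          exceeds_congr fun i j hij => by rw [h1 i j hij]
      change Failure _ _ _ _ _ _ _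
      simpa only [Failure, hinit, hrefine] using h
    have h9 := orthDist_le_of_not_failure hn4 hn12 hsmall hf hcl hcL hce h4 h5 h6 h2 h8 h3
    refine h9.trans ?_
    have : 0 ≤ 56 * Real.pi ^ 2 * rate n := by positivity
    linarith
  -- Subadditivity suffices, so the event itself need not be known to be measurable.
  have htot := measureReal_union_le (μ := μ) {ω | orthDist (xhat ω) (x ω) ≤
      ((1 + 8 * Real.pi) * refineConst cl cL ce + 56 * Real.pi ^ 2) * rate n}
      {ω | orthDist (xhat ω) (x ω) ≤
      ((1 + 8 * Real.pi) * refineConst cl cL ce + 56 * Real.pi ^ 2) * rate n}ᶜ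
  rw [union_compl_self, probReal_univ] at htot
  linarith
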